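/- Let $\Omega\subset(\mathbb R\setminus\{0\})^d$ be open and non-empty. All products $xy=(x_1y_1,\dots,x_dy_d)$ and reciprocals $1/x=(1/x_1,\dots,1/x_d)$ are taken coordinatewise. A *Hadamard operator* on $\mathcal D'(\Omega)$ is a continuous linear operator $L:\mathcal D'(\Omega)\to\mathcal D'(\Omega)$ such that for every $\alpha\in\mathbb N_0^d$ the monomial $\xi^\alpha$, regarded as the distribution $\varphi\mapsto\int\xi^\alpha\varphi(\xi)\,d\xi$, is an eigenvector of $L$. Put $$V_*(\Omega)=\{\eta\in(\mathbb R\setminus\{0\})^d:\ \eta\,\Omega\subset\Omega\},\qquad 1/M=\{1/x:\ x\in M\}\quad\text{for } M\subset(\mathbb R\setminus\{0\})^d .$$ For $S\in\mathcal D'(\Omega)$ and $T\in\mathcal D'((\mathbb R\setminus\{0\})^d)$ the multiplicative convolution is $$(S\star T)\varphi=S_y\bigl(T_x\,\varphi(xy)\bigr),$$ which makes sense for $\varphi\in\mathcal D(\Omega)$ if the function $y\mapsto T_x\varphi(xy)$ belongs to $\mathcal D(\Omega)$. Let $\mathcal E'((\mathbb R\setminus\{0\})^d)$ be the space of distributions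 on $(\mathbb R\setminus\{0\})^d$ whose support is a compact subset of $(\mathbb R\setminus\{0\})^d$. **Theorem.** If $T\in\mathcal E'((\mathbb R\setminus\{0\})^d)$ and $1/\operatorname{supp}T\subset V_*(\Omega)$, then for every $S\in\mathcal D'(\Omega)$ the formula for $S\star T$ makes sense for all $\varphi\in\mathcal D(\Omega)$ and defines a distribution $S\star T\in\mathcal D'(\Omega)$. A map $L:\mathcal D'(\Omega)\to\mathcal D'(\Omega)$ is a Hadamard operator if and only if there is a distribution $T\in\mathcal E'((\mathbb R\setminus\{0\})^d)$ with $1/\operatorname{supp}T\subset V_*(\Omega)$ such that $L(S)=S\star T$ for all $S\in\mathcal D'(\Omega)$. (This holds for real-valued as well as for complex-valued distributions.) -/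

import Mathlib

open TopologicalSpace MeasureTheory
open scoped Distributions CompactConvergenceCLM

noncomputable section

/-- The open set `(ℝ ∖ {0})^d` of all points of `ℝ^d` none of whose coordinates vanishes.
The space `ℝ^d` is `Fin d → ℝ`; its product `x * y`, its inverse `x⁻¹` and its unit `1` are
the coordinatewise ones. -/
def nonzeroCoords (d : ℕ) : Opens (Fin d → ℝ) where
  carrier := {x | ∀ j, x j ≠ 0}
  is_open' := by
    simp only [Set.ofPred_forall]
    exact isOpen_iInter_of_finite fun j => isOpen_ne_fun (continuous_apply j) continuous_const

/-- `𝓓'(Ω)`: the continuous `𝕜`-linear functionals on the space of `𝕜`-valued test functions on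
`Ω` (with its canonical LF topology). The space carries the topology of uniform convergence on
compact sets of test functions; this is the strong dual topology, because the space of test
functions is a Montel space. For `𝕜 = ℝ` this is Mathlib's `Distribution Ω ℝ ⊤`. -/
abbrev ScalarDistribution (𝕜 : Type*) [RCLike 𝕜] {d : ℕ} (Ω : Opens (Fin d → ℝ)) :=
  𝓓(Ω, 𝕜) →L_c[𝕜] 𝕜

/-- The monomial `ξ ^ α`, regarded as a distribution on `Ω`: `φ ↦ ∫ φ(ξ) ξ ^ α dξ`, with the
Lebesgue integral. -/
def monomialDistribution (𝕜 : Type*) [RCLike 𝕜] {d : ℕ} (Ω : Opens (Fin d → ℝ))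
    (α : Fin d → ℕ) : ScalarDistribution 𝕜 Ω :=
  (TestFunction.integralAgainstBilinCLM (ContinuousLinearMap.mul 𝕜 𝕜) volume
    (fun ξ : Fin d → ℝ => ((∏ j, ξ j ^ α j : ℝ) : 𝕜)) : 𝓓(Ω, 𝕜) →L[𝕜] 𝕜)

/-- The integral in `monomialDistribution` is never a junk value: monomials are locally
integrable. -/
theorem monomialDistribution_apply (𝕜 : Type*) [RCLike 𝕜] {d : ℕ} (Ω : Opens (Fin d → ℝ))
    (α : Fin d → ℕ) (φ : 𝓓(Ω, 𝕜)) :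
    monomialDistribution 𝕜 Ω α φ = ∫ ξ : Fin d → ℝ, φ ξ * ((∏ j, ξ j ^ α j : ℝ) : 𝕜) := by
  have h : LocallyIntegrableOn (fun ξ : Fin d → ℝ => ((∏ j, ξ j ^ α j : ℝ) : 𝕜)) Ω volume := by
    refine (Continuous.locallyIntegrable ?_).locallyIntegrableOn _
    exact RCLike.continuous_ofReal.comp
      (continuous_finsetProd _ fun j _ => (continuous_apply j).pow _)
  exact TestFunction.integralAgainstBilinCLM_eq_integral h

/-- A Hadamard operator on `𝓓'(Ω)` is a continuous linear map of `𝓓'(Ω)` into itself which has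
every monomial as an eigenvector. -/
def IsHadamardOperator {𝕜 : Type*} [RCLike 𝕜] {d : ℕ} {Ω : Opens (Fin d → ℝ)}
    (L : ScalarDistribution 𝕜 Ω → ScalarDistribution 𝕜 Ω) : Prop :=
  ∃ A : ScalarDistribution 𝕜 Ω →L[𝕜] ScalarDistribution 𝕜 Ω, ⇑A = L ∧
    ∀ α : Fin d → ℕ, ∃ m : 𝕜,
      Module.End.HasEigenvector (A : ScalarDistribution 𝕜 Ω →ₗ[𝕜] ScalarDistribution 𝕜 Ω) m
        (monomialDistribution 𝕜 Ω α)

/-- The support of a distribution on `Ω`, as a subset of `Ω`: the points of `Ω` near which the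
distribution does not vanish. -/
def supportIn {𝕜 : Type*} [RCLike 𝕜] {d : ℕ} {Ω : Opens (Fin d → ℝ)}
    (T : ScalarDistribution 𝕜 Ω) : Set (Fin d → ℝ) :=
  Distribution.dsupport T ∩ (Ω : Set (Fin d → ℝ))

/-- `V_*(M)`: the `η` with nonzero coordinates such that `η M ⊆ M`. -/
def dilationSet {d : ℕ} (M : Set (Fin d → ℝ)) : Set (Fin d → ℝ) :=
  {η | η ∈ nonzeroCoords d ∧ ∀ x ∈ M, η * x ∈ M}

/-- For a test function `φ` on `Ω ⊆ (ℝ ∖ {0})^d` and `y ∈ (ℝ ∖ {0})^d`, the test function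
`x ↦ φ (x y)` on `(ℝ ∖ {0})^d`. -/
def dilateTestFunction {𝕜 : Type*} [RCLike 𝕜] {d : ℕ} {Ω : Opens (Fin d → ℝ)}
    (hΩ : Ω ≤ nonzeroCoords d) (φ : 𝓓(Ω, 𝕜)) (y : Fin d → ℝ) (hy : y ∈ nonzeroCoords d) :
    𝓓(nonzeroCoords d, 𝕜) :=
  let e : (Fin d → ℝ) ≃ₜ (Fin d → ℝ) :=
    Homeomorph.piCongrRight fun j => Homeomorph.mulRight₀ (y j) (hy j)
  have hts : tsupport (fun x => φ (x * y)) = e ⁻¹' tsupport φ :=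
    tsupport_comp_eq_preimage (φ : (Fin d → ℝ) → 𝕜) e
  { toFun := fun x => φ (x * y)
    contDiff' := φ.contDiff.comp (contDiff_id.mul contDiff_const)
    hasCompactSupport' := φ.hasCompactSupport.comp_homeomorph e
    tsupport_subset' := by
      rw [hts]
      intro x hx j hxj
      refine hΩ (φ.tsupport_subset hx) j ?_
      change x j * y j = 0
      rw [hxj, zero_mul] }

/-- `IsMulConv hΩ S T R` says that the multiplicative convolution `S ⋆ T`, given by
`(S ⋆ T) φ = S_y (T_x φ(x y))`, makes sense for all test functions `φ` on `Ω` and is the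
distribution `R`. That it makes sense for `φ` means that the function `y ↦ T_x φ(x y)` is a test
function `ψ` on `Ω`, so that `S` can be applied to it. -/
def IsMulConv {𝕜 : Type*} [RCLike 𝕜] {d : ℕ} {Ω : Opens (Fin d → ℝ)}
    (hΩ : Ω ≤ nonzeroCoords d) (S : ScalarDistribution 𝕜 Ω)
    (T : ScalarDistribution 𝕜 (nonzeroCoords d)) (R : ScalarDistribution 𝕜 Ω) : Prop :=
  ∀ φ : 𝓓(Ω, 𝕜), ∃ ψ : 𝓓(Ω, 𝕜),
    (∀ (y : Fin d → ℝ) (hy : y ∈ nonzeroCoords d), ψ y = T (dilateTestFunction hΩ φ y hy)) ∧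
      R φ = S ψ

/-- The compactly supported distributions `T` on `(ℝ ∖ {0})^d` with `1 / supp T ⊆ V_*(Ω)`. -/
def IsHadamardSymbol {𝕜 : Type*} [RCLike 𝕜] {d : ℕ} (Ω : Opens (Fin d → ℝ))
    (T : ScalarDistribution 𝕜 (nonzeroCoords d)) : Prop :=
  IsCompact (supportIn T) ∧ (fun x => x⁻¹) '' supportIn T ⊆ dilationSet (Ω : Set (Fin d → ℝ))

end

/-! The theorem is a statement about transposes. A continuous functional on `𝓓'(Ω)` is controlled by
a compact set of test functions, and such a set lies in a compact, convex, balanced set of functions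
with fixed support and prescribed derivative bounds. Separation in finite dimensions plus the finite
intersection property then turn the functional into evaluation at a test function
(`exists_testFunction_of_continuous`). So every continuous operator is the transpose of a map `M` of
test functions. The same duality provides weak integrals, which justify interchanging a distribution
with integrals and derivatives in a parameter.

If `T` is a symbol, `y ↦ T_x φ(xy)` is smooth with support in `supp φ / supp T`, hence in `Ω`, and
depends continuously on `φ`; its transpose is convolution with `T`. Substituting `z = xy` in its
moments shows that monomials are eigenvectors, with eigenvalue `T_x (|∏ x_j|⁻¹ x^{-α})`
(`exists_moment_eq`).

Conversely, the eigenvector condition says that `M` multiplies the `α`-th moment by a constant.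
Compactly supported continuous functions are determined by their moments, so `M` commutes with
dilations (`transpose_dilate`). One would like to set `T φ = (M φ)(1)`, but `1` need not lie in `Ω`;
instead `T` is assembled from pieces moved into a small ball in `Ω` by dilations
(`exists_symbol_of_dilate`). Continuity on `𝓓'(Ω)` gives a common compact support of `M φ` for all
`φ` supported in that ball (`exists_support_bound`), and this makes `supp T` compact. The inclusion
`1 / supp T ⊆ V_*(Ω)` holds because `M φ` vanishes off `Ω`. -/

noncomputable section

/-! ### Compactness of sets of test functions with bounded derivatives. -/

section Montel

open Filter Topology

variable {E F : Type*} [NormedAddCommGroup E] [NormedSpace ℝ E]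
  [NormedAddCommGroup F] [NormedSpace ℝ F]

/-- The smooth functions supported in `K` all of whose derivatives obey prescribed bounds. -/
def derivBoundedSet (F : Type*) [NormedAddCommGroup F] [NormedSpace ℝ F] (K : Compacts E)
    (B : ℕ → ℝ) : Set 𝓓_{K}(E, F) :=
  {f | ∀ i x, ‖iteratedFDeriv ℝ i f x‖ ≤ B i}

/-- The bound on derivatives of order `i + 1` makes those of order `i` equi-Lipschitz, so pointwise
convergence is uniform on the compact set `K`; off `K` everything vanishes. -/
theorem tendstoUniformly_iteratedFDeriv_of_derivBoundedSet {K : Compacts E} {B : ℕ → ℝ}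
    {l : Filter (derivBoundedSet F K B)} [l.NeBot] {i : ℕ}
    {g : E → ContinuousMultilinearMap ℝ (fun _ : Fin i => E) F}
    (hg : ∀ x, Tendsto (fun f : derivBoundedSet F K B => iteratedFDeriv ℝ i f.1 x) l (𝓝 (g x))) :
    TendstoUniformly (fun (f : derivBoundedSet F K B) x => iteratedFDeriv ℝ i f.1 x) g l := by
  have hlip : ∀ f : derivBoundedSet F K B,
      LipschitzWith (B (i + 1)).toNNReal (iteratedFDeriv ℝ i f.1) := by
    intro f
    refine lipschitzWith_of_nnnorm_fderiv_le (𝕜 := ℝ) ?_ ?_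
    · exact f.1.contDiff.differentiable_iteratedFDeriv (mod_cast ENat.natCast_lt_top i)
    · intro x
      rw [← NNReal.coe_le_coe, coe_nnnorm, norm_fderiv_iteratedFDeriv]
      exact (f.2 (i + 1) x).trans (Real.le_coe_toNNReal _)
  have hequi : EquicontinuousOn (fun (f : derivBoundedSet F K B) x => iteratedFDeriv ℝ i f.1 x)
      (K : Set E) := by
    have : UniformEquicontinuous
        (fun (f : derivBoundedSet F K B) x => iteratedFDeriv ℝ i f.1 x) :=
      LipschitzWith.uniformEquicontinuous _ _ hlip
    exact this.equicontinuous.equicontinuousOn _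
  have hK : TendstoUniformlyOn (fun (f : derivBoundedSet F K B) x => iteratedFDeriv ℝ i f.1 x) g l
      (K : Set E) := by
    have := (EquicontinuousOn.tendsto_uniformOnFun_iff_pi' (𝔖 := {(K : Set E)})
      (F := fun (f : derivBoundedSet F K B) x => iteratedFDeriv ℝ i f.1 x)
      (by simpa using K.isCompact) (fun L hL => Set.mem_singleton_iff.1 hL ▸ hequi) l g).2
      (tendsto_pi_nhds.2 fun x => hg x.1)
    exact UniformOnFun.tendsto_iff_tendstoUniformlyOn.1 this _ rfl
  have hout : ∀ x ∉ (K : Set E), g x = 0 := by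
    intro x hx
    refine tendsto_nhds_unique (hg x) ?_
    refine tendsto_const_nhds.congr fun f => ?_
    exact (f.1.iteratedFDeriv_zero_on_compl hx).symm
  rw [Metric.tendstoUniformlyOn_iff] at hK
  rw [Metric.tendstoUniformly_iff]
  intro ε hε
  filter_upwards [hK ε hε] with f hf x
  by_cases hx : x ∈ (K : Set E)
  · exact hf x hx
  · rw [hout x hx, f.1.iteratedFDeriv_zero_on_compl hx]
    simpa using hε

/-- Along an ultrafilter all derivatives converge pointwise, since they stay in balls of
finite-dimensional spaces. The convergence is uniform, so the limits are the derivatives of one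
smooth function. -/
theorem isCompact_derivBoundedSet [FiniteDimensional ℝ E] [FiniteDimensional ℝ F]
    (K : Compacts E) (B : ℕ → ℝ) : IsCompact (derivBoundedSet F K B) := by
  rw [isCompact_iff_compactSpace, ← isCompact_univ_iff, isCompact_iff_ultrafilter_le_nhds]
  intro U _
  have hlim : ∀ i x, ∃ v, Tendsto (fun f : derivBoundedSet F K B => iteratedFDeriv ℝ i f.1 x) U
      (𝓝 v) := by
    intro i x
    have : FiniteDimensional ℝ (ContinuousMultilinearMap ℝ (fun _ : Fin i => E) F) :=
      FiniteDimensional.of_injective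
        (ContinuousMultilinearMap.toMultilinearMapLinear (R' := ℝ) (A := ℝ)
          (M₁ := fun _ : Fin i => E) (M₂ := F))
        ContinuousMultilinearMap.toMultilinearMap_injective
    have : ProperSpace (ContinuousMultilinearMap ℝ (fun _ : Fin i => E) F) :=
      FiniteDimensional.proper ℝ _
    obtain ⟨v, -, hv⟩ := (isCompact_closedBall (0 : ContinuousMultilinearMap ℝ
      (fun _ : Fin i => E) F) (B i)).ultrafilter_le_nhds
        (U.map fun f : derivBoundedSet F K B => iteratedFDeriv ℝ i f.1 x) (by
          rw [le_principal_iff]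
          refine Filter.mem_map.2 (Filter.univ_mem' fun f => ?_)
          simpa using f.2 i x)
    exact ⟨v, hv⟩
  choose g hg using hlim
  have hunif := fun i => tendstoUniformly_iteratedFDeriv_of_derivBoundedSet (hg i)
  set g0 : E → F := fun x => (g 0 x) 0 with hg0
  have hT : HasFTaylorSeriesUpTo (⊤ : ℕ∞) g0 (fun x i => g i x) := by
    refine ⟨fun x => rfl, ?_, ?_⟩
    · intro i _ x
      have hcont : Tendsto
          (fun f : derivBoundedSet F K B => iteratedFDeriv ℝ (i + 1) f.1 x) U (𝓝 (g (i + 1) x)) :=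
        hg _ x
      refine hasFDerivAt_of_tendstoUniformly (𝕜 := ℝ) (l := (U : Filter (derivBoundedSet F K B)))
        (f := fun f x => iteratedFDeriv ℝ i f.1 x)
        (f' := fun f x => (iteratedFDeriv ℝ (i + 1) f.1 x).curryLeft)
        (g' := fun x => (g (i + 1) x).curryLeft) ?_ ?_ (hg i) x
      · have := (continuousMultilinearCurryLeftEquiv ℝ (fun _ : Fin (i + 1) => E) F).isometry
        exact this.uniformContinuous.comp_tendstoUniformly (hunif (i + 1))
      · intro f x
        have := (f.1.contDiff.differentiable_iteratedFDeriv
          (m := i) (mod_cast ENat.natCast_lt_top i) x).hasFDerivAt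
        rwa [fderiv_iteratedFDeriv] at this
    · intro i _
      refine (hunif i).continuous (Filter.Eventually.frequently (Filter.Eventually.of_forall ?_))
      intro f
      exact f.1.contDiff.continuous_iteratedFDeriv (mod_cast le_top)
  have hder : ∀ i x, iteratedFDeriv ℝ i g0 x = g i x := fun i x =>
    (hT.eq_iteratedFDeriv (m := i) (mod_cast le_top) x).symm
  have hsm : ContDiff ℝ (⊤ : ℕ∞) g0 := hT.contDiff
  have hsupp : Set.EqOn g0 0 (K : Set E)ᶜ := by
    intro x hx
    have : g 0 x = 0 := by
      refine tendsto_nhds_unique (hg 0 x) (tendsto_const_nhds.congr fun f => ?_)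
      exact (f.1.iteratedFDeriv_zero_on_compl hx).symm
    simp [hg0, this]
  set G : 𝓓_{K}(E, F) := ⟨g0, hsm, hsupp⟩ with hG
  have hGmem : G ∈ derivBoundedSet F K B := by
    intro i x
    change ‖iteratedFDeriv ℝ i g0 x‖ ≤ B i
    rw [hder]
    exact le_of_tendsto (hg i x).norm (Filter.Eventually.of_forall fun f => f.2 i x)
  refine ⟨⟨G, hGmem⟩, trivial, ?_⟩
  rw [nhds_subtype, ← Filter.map_le_iff_le_comap]
  change Tendsto (fun f : derivBoundedSet F K B => f.1) U (𝓝 G)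
  rw [(ContDiffMapSupportedIn.isUniformEmbedding_pi_structureMapCLM
    (𝕜 := ℝ) (E := E) (F := F) (n := ⊤) (K := K)).isInducing.tendsto_nhds_iff, tendsto_pi_nhds]
  intro i
  rw [BoundedContinuousFunction.tendsto_iff_tendstoUniformly]
  have h1 : ∀ f : 𝓓_{K}(E, F), ⇑(ContDiffMapSupportedIn.structureMapCLM ℝ ⊤ i f)
      = iteratedFDeriv ℝ i f := fun f => ContDiffMapSupportedIn.structureMapCLM_top_apply ℝ f
  have h2 := hunif i
  have h3 : (g i) = iteratedFDeriv ℝ i G := funext fun x => (hder i x).symm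
  rw [h3] at h2
  simpa [h1, Function.comp_def] using h2

end Montel

/-! ### Compact sets in the LF space of test functions. -/

section CompactSets

open Filter Topology

variable {E F : Type*} [NormedAddCommGroup E] [NormedSpace ℝ E]
  [NormedAddCommGroup F] [NormedSpace ℝ F] {Ω : Opens E}

/-- A linear map from test functions to functions with values in a normed space which is
continuous on each `𝓓_{K}(E, F)` for the supremum norm is uniformly bounded on compact sets. -/
theorem exists_bound_of_isCompact {X G : Type*} [NormedAddCommGroup G] [NormedSpace ℝ G]
    (D : 𝓓(Ω, F) →ₗ[ℝ] (X → G))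
    (hD : ∀ (K : Compacts E) (hK : (K : Set E) ⊆ Ω), ∃ (s : Finset ℕ) (C : ℝ), 0 ≤ C ∧
      ∀ (f : 𝓓_{K}(E, F)) x, ‖D (TestFunction.ofSupportedIn hK f) x‖ ≤
        C * (s.sup fun i => ContDiffMapSupportedIn.seminorm ℝ E F ⊤ K i) f)
    {S : Set 𝓓(Ω, F)} (hS : IsCompact S) :
    ∃ R, 0 ≤ R ∧ ∀ f ∈ S, ∀ x, ‖D f x‖ ≤ R := by
  -- With the discrete topology every bounded function on `X` is bounded continuous, so `D` becomes
  -- a continuous map into a normed space and compact sets have bounded image.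
  let : TopologicalSpace X := ⊥
  have : DiscreteTopology X := ⟨rfl⟩
  have hbd : ∀ g, ∃ C, ∀ x, ‖D g x‖ ≤ C := by
    intro g
    obtain ⟨s, C, -, h⟩ := hD ⟨tsupport g, g.hasCompactSupport⟩ g.tsupport_subset
    exact ⟨_, h ⟨g, g.contDiff, fun x hx => image_eq_zero_of_notMem_tsupport hx⟩⟩
  let Φ₀ : 𝓓(Ω, F) → BoundedContinuousFunction X G := fun g =>
    ⟨⟨D g, continuous_of_discreteTopology⟩, by
      obtain ⟨C, hC⟩ := hbd g
      exact ⟨_, fun a b => (dist_le_norm_add_norm _ _).trans (add_le_add (hC a) (hC b))⟩⟩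
  have hΦ₀ : ∀ g x, Φ₀ g x = D g x := fun _ _ => rfl
  let Φ : 𝓓(Ω, F) →L[ℝ] BoundedContinuousFunction X G :=
    TestFunction.limitCLM ℝ Φ₀
      (fun L hL => ContDiffMapSupportedIn.mkCLMtoNormedSpace ℝ
        (fun g => Φ₀ (TestFunction.ofSupportedIn hL g))
        (fun g h => by
          ext x
          have : TestFunction.ofSupportedIn hL (g + h) =
            TestFunction.ofSupportedIn hL g + TestFunction.ofSupportedIn hL h := rfl
          simp [hΦ₀, this])
        (fun a g => by
          ext x
          have : TestFunction.ofSupportedIn hL (a • g) =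
            a • TestFunction.ofSupportedIn hL g := rfl
          simp [hΦ₀, this])
        (by
          obtain ⟨s, C, hC, h⟩ := hD L hL
          refine ⟨s, C, hC, fun g => ?_⟩
          rw [BoundedContinuousFunction.norm_le (mul_nonneg hC (apply_nonneg _ _))]
          exact h g))
      (fun _ _ _ => rfl)
  obtain ⟨R, hR⟩ := (hS.image Φ.continuous).isBounded.exists_norm_le
  refine ⟨max R 0, le_max_right _ _, fun f hf x => ?_⟩
  exact (((Φ f).norm_coe_le_norm x).trans (hR _ ⟨f, hf, rfl⟩)).trans (le_max_left _ _)

theorem exists_compact_exhaustion [FiniteDimensional ℝ E] (Ω : Opens E) :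
    ∃ K : ℕ → Set E, (∀ n, IsCompact (K n)) ∧ (∀ n, K n ⊆ Ω) ∧ Monotone K ∧
      ∀ L : Set E, IsCompact L → L ⊆ Ω → ∃ n, L ⊆ K n := by
  have : ProperSpace E := FiniteDimensional.proper ℝ E
  have : LocallyCompactSpace Ω := Ω.isOpen.locallyCompactSpace
  let K := CompactExhaustion.choice Ω
  refine ⟨fun n => Subtype.val '' (K n), fun n => (K.isCompact n).image continuous_subtype_val,
    fun n => ?_, fun m n h => Set.image_mono (K.subset h), fun L hL hLΩ => ?_⟩
  · rintro _ ⟨x, -, rfl⟩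
    exact x.2
  · have hL' : IsCompact (Subtype.val ⁻¹' L : Set Ω) :=
      Topology.IsInducing.subtypeVal.isCompact_preimage' hL (by simpa using hLΩ)
    obtain ⟨n, hn⟩ := K.exists_superset_of_isCompact hL'
    exact ⟨n, fun x hx => ⟨⟨x, hLΩ hx⟩, hn hx, rfl⟩⟩

/-- The test functions in a compact set have a common compact support. -/
theorem exists_common_support [FiniteDimensional ℝ E] {C : Set 𝓓(Ω, F)} (hC : IsCompact C) :
    ∃ K : Compacts E, (K : Set E) ⊆ Ω ∧ ∀ f ∈ C, Set.EqOn f 0 (K : Set E)ᶜ := by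
  obtain ⟨K, hKc, hKΩ, hKm, hKe⟩ := exists_compact_exhaustion Ω
  by_contra! hcon
  have hcon' : ∀ n, ∃ f ∈ C, ∃ x ∉ K n, f x ≠ 0 := by
    intro n
    obtain ⟨f, hf, h⟩ := hcon ⟨K n, hKc n⟩ (hKΩ n)
    simp only [Set.EqOn, not_forall] at h
    obtain ⟨x, hx, hne⟩ := h
    exact ⟨f, hf, x, hx, hne⟩
  choose f hfC x hxK hfx using hcon'
  -- The weights make the `n`-th weighted evaluation of `f n` have norm `n`. Each compact subset of
  -- `Ω` contains `x n` for only finitely many indices, so the weighted evaluations are continuous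
  -- on each step of the LF space and must be bounded on `C`.
  set c : ℕ → ℝ := fun n => n / ‖f n (x n)‖ with hc
  have hzero : ∀ L : Set E, IsCompact L → L ⊆ Ω → ∃ N, ∀ n ≥ N, x n ∉ L := by
    intro L hL hLΩ
    obtain ⟨N, hN⟩ := hKe L hL hLΩ
    exact ⟨N, fun n hn hx => hxK n (hKm hn (hN hx))⟩
  obtain ⟨R, -, hR⟩ := exists_bound_of_isCompact (X := ℕ) (G := F)
    { toFun := fun g n => c n • g (x n)
      map_add' := fun g h => by ext n; simp
      map_smul' := fun a g => by ext n; simp [smul_comm a] } (by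
      intro L hL
      obtain ⟨N, hN⟩ := hzero L L.isCompact hL
      refine ⟨{0}, ∑ k ∈ Finset.range N, |c k|, by positivity, fun g n => ?_⟩
      rw [Finset.sup_singleton]
      change ‖c n • g (x n)‖ ≤ _
      rcases lt_or_ge n N with h | h
      · rw [norm_smul, Real.norm_eq_abs]
        gcongr
        · exact Finset.single_le_sum (f := fun k => |c k|) (fun _ _ => abs_nonneg _)
            (Finset.mem_range.2 h)
        · exact ContDiffMapSupportedIn.norm_apply_le_seminorm ℝ
      · have : g (x n) = 0 := g.zero_on_compl (hN n h)
        rw [this, smul_zero, norm_zero]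
        positivity) hC
  obtain ⟨n, hn⟩ := exists_nat_gt R
  have h2 : ‖c n • f n (x n)‖ ≤ R := hR (f n) (hfC n) n
  rw [norm_smul, hc, norm_div, norm_norm, div_mul_cancel₀ _ (norm_ne_zero_iff.2 (hfx n))] at h2
  simp at h2
  linarith

/-- A compact set of test functions is contained in a set of functions supported in a fixed
compact set and with uniform bounds on all derivatives. -/
theorem exists_derivBoundedSet_superset [FiniteDimensional ℝ E] {C : Set 𝓓(Ω, F)}
    (hC : IsCompact C) :
    ∃ (K : Compacts E) (hK : (K : Set E) ⊆ Ω) (B : ℕ → ℝ), (∀ i, 0 ≤ B i) ∧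
      C ⊆ TestFunction.ofSupportedIn hK '' derivBoundedSet F K B := by
  obtain ⟨K, hK, hsupp⟩ := exists_common_support hC
  have hB : ∀ i, ∃ R : ℝ, 0 ≤ R ∧ ∀ f ∈ C, ∀ x, ‖iteratedFDeriv ℝ i f x‖ ≤ R := by
    intro i
    obtain ⟨R, hR0, hR⟩ := exists_bound_of_isCompact (X := E)
      (G := ContinuousMultilinearMap ℝ (fun _ : Fin i => E) F) (Ω := Ω) (F := F)
      { toFun := fun g => iteratedFDeriv ℝ i g
        map_add' := fun g h => by
          ext1 x
          exact iteratedFDeriv_add_apply (g.contDiff.contDiffAt.of_le (mod_cast le_top))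
            (h.contDiff.contDiffAt.of_le (mod_cast le_top))
        map_smul' := fun a g => by
          ext1 x
          exact iteratedFDeriv_const_smul_apply
            (g.contDiff.contDiffAt.of_le (mod_cast le_top)) } (by
        intro L hL
        refine ⟨{i}, 1, zero_le_one, fun g x => ?_⟩
        rw [Finset.sup_singleton, one_mul]
        exact ContDiffMapSupportedIn.norm_iteratedFDeriv_apply_le_seminorm_top ℝ) hC
    exact ⟨R, hR0, hR⟩
  choose B hB0 hB using hB
  refine ⟨K, hK, B, hB0, fun f hf => ⟨⟨f, f.contDiff, hsupp f hf⟩, fun i x => hB i f hf x, ?_⟩⟩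
  ext x
  rfl

end CompactSets

/-! ### Reflexivity: functionals on distributions are test functions. -/

section Duality

open Filter Topology

variable {𝕜 E : Type*} [RCLike 𝕜] [NormedAddCommGroup E] [NormedSpace ℝ E] {Ω : Opens E}

theorem zero_mem_derivBoundedSet {F : Type*} [NormedAddCommGroup F] [NormedSpace ℝ F]
    {K : Compacts E} {B : ℕ → ℝ} (hB : ∀ i, 0 ≤ B i) : (0 : 𝓓_{K}(E, F)) ∈ derivBoundedSet F K B := by
  intro i x
  have : iteratedFDeriv ℝ i ((0 : 𝓓_{K}(E, F)) : E → F) = 0 := iteratedFDeriv_fun_zero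
  rw [this]
  simpa using hB i

theorem smul_mem_derivBoundedSet {K : Compacts E} {B : ℕ → ℝ} {f : 𝓓_{K}(E, 𝕜)}
    (hf : f ∈ derivBoundedSet 𝕜 K B) (c : 𝕜) :
    c • f ∈ derivBoundedSet 𝕜 K (fun i => ‖c‖ * B i) := by
  intro i x
  have : iteratedFDeriv ℝ i ((c • f : 𝓓_{K}(E, 𝕜)) : E → 𝕜) x = c • iteratedFDeriv ℝ i f x :=
    iteratedFDeriv_const_smul_apply (f.contDiff.contDiffAt.of_le (mod_cast le_top))
  rw [this, norm_smul]
  exact mul_le_mul_of_nonneg_left (hf i x) (norm_nonneg c)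

theorem convex_derivBoundedSet {F : Type*} [NormedAddCommGroup F] [NormedSpace ℝ F]
    (K : Compacts E) (B : ℕ → ℝ) : Convex ℝ (derivBoundedSet F K B) := by
  intro f hf g hg a b ha hb hab i x
  have hfc := f.contDiff.contDiffAt.of_le (x := x) (m := i) (mod_cast le_top)
  have hgc := g.contDiff.contDiffAt.of_le (x := x) (m := i) (mod_cast le_top)
  have : iteratedFDeriv ℝ i ((a • f + b • g : 𝓓_{K}(E, F)) : E → F) x =
      a • iteratedFDeriv ℝ i f x + b • iteratedFDeriv ℝ i g x := by
    have h1 : ((a • f + b • g : 𝓓_{K}(E, F)) : E → F) = a • (f : E → F) + b • (g : E → F) := rfl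
    have hfa : ContDiffAt ℝ i (a • (f : E → F)) x := hfc.const_smul a
    have hgb : ContDiffAt ℝ i (b • (g : E → F)) x := hgc.const_smul b
    rw [h1, iteratedFDeriv_add_apply hfa hgb,
      iteratedFDeriv_const_smul_apply hfc, iteratedFDeriv_const_smul_apply hgc]
  rw [this]
  calc ‖a • iteratedFDeriv ℝ i f x + b • iteratedFDeriv ℝ i g x‖
      ≤ a * B i + b * B i := by
        refine (norm_add_le _ _).trans (add_le_add ?_ ?_)
        · rw [norm_smul, Real.norm_of_nonneg ha]
          exact mul_le_mul_of_nonneg_left (hf i x) ha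
        · rw [norm_smul, Real.norm_of_nonneg hb]
          exact mul_le_mul_of_nonneg_left (hg i x) hb
    _ = B i := by rw [← add_mul, hab, one_mul]

/-- A continuous functional on the space of distributions is bounded by the supremum over a compact
set of test functions. -/
theorem exists_compact_bound (Λ : (𝓓(Ω, 𝕜) →L_c[𝕜] 𝕜) →L[𝕜] 𝕜) :
    ∃ C : Set 𝓓(Ω, 𝕜), IsCompact C ∧ ∃ ε > 0, ∀ S : 𝓓(Ω, 𝕜) →L_c[𝕜] 𝕜,
      (∀ φ ∈ C, ‖S φ‖ < ε) → ‖Λ S‖ < 1 := by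
  have hn : {S : 𝓓(Ω, 𝕜) →L_c[𝕜] 𝕜 | ‖Λ S‖ < 1} ∈ 𝓝 0 := by
    refine (isOpen_lt Λ.continuous.norm continuous_const).mem_nhds ?_
    simp
  obtain ⟨⟨C, ε⟩, ⟨hC, hε⟩, hsub⟩ :=
    (CompactConvergenceCLM.hasBasis_nhds_zero_of_basis (σ := RingHom.id 𝕜)
      (E := 𝓓(Ω, 𝕜)) (F := 𝕜) Metric.nhds_basis_ball).mem_iff.1 hn
  refine ⟨C, hC, ε, hε, fun S hS => hsub fun φ hφ => ?_⟩
  simpa using hS φ hφ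

/-- If a vector of scalars is dominated by the values on a compact convex balanced set of finitely
many functionals, it is attained there. -/
theorem exists_mem_forall_apply_eq {ι X : Type*} [Fintype ι] [AddCommGroup X] [Module 𝕜 X]
    [Module ℝ X] [IsScalarTower ℝ 𝕜 X] [TopologicalSpace X] {Γ : Set X} (hΓc : IsCompact Γ)
    (hΓ : Convex ℝ Γ) (h0 : (0 : X) ∈ Γ) (hbal : ∀ f ∈ Γ, ∀ c : 𝕜, ‖c‖ = 1 → c • f ∈ Γ)
    (S : ι → X →L[𝕜] 𝕜) (v : ι → 𝕜)
    (hv : ∀ (c : ι → 𝕜) (u : ℝ), 0 < u → (∀ f ∈ Γ, ‖∑ i, c i * S i f‖ ≤ u) →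
      ‖∑ i, c i * v i‖ ≤ u) :
    ∃ f ∈ Γ, ∀ i, S i f = v i := by
  classical
  let P : X →L[𝕜] (ι → 𝕜) := ContinuousLinearMap.pi S
  by_contra hcon
  have hx : v ∉ P '' Γ := by
    rintro ⟨f, hf, hfx⟩
    exact hcon ⟨f, hf, fun i => congrFun hfx i⟩
  have hconv : Convex ℝ (P '' Γ) :=
    hΓ.linear_image ((P : X →ₗ[𝕜] (ι → 𝕜)).restrictScalars ℝ)
  -- The image of `Γ` is compact and convex in a finite-dimensional space; the coefficients of a
  -- functional separating `v` from it contradict `hv`.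
  obtain ⟨g, u, hg1, hg2⟩ := RCLike.geometric_hahn_banach_closed_point (𝕜 := 𝕜) hconv
    (hΓc.image P.continuous).isClosed hx
  have hg : ∀ w : ι → 𝕜, g w = ∑ i, g (Pi.single i 1) * w i := by
    intro w
    have hw : w = ∑ i, w i • (Pi.single i 1 : ι → 𝕜) := by
      ext j
      simp [Finset.sum_apply, Pi.single_apply]
    conv_lhs => rw [hw]
    rw [map_sum]
    refine Finset.sum_congr rfl fun i _ => ?_
    rw [map_smul, smul_eq_mul, mul_comm]
  have hgP : ∀ f, ∑ i, g (Pi.single i 1) * S i f = g (P f) := fun f => (hg (P f)).symm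
  have hu : 0 < u := by simpa using hg1 0 ⟨0, h0, map_zero _⟩
  have h1 := hv (fun i => g (Pi.single i 1)) u hu (by
    intro f hf
    rw [hgP]
    -- Separation only bounds real parts; since `Γ` is balanced, `f` can be rotated until the real
    -- part is the norm.
    obtain ⟨c, hc, hc'⟩ := RCLike.exists_norm_eq_mul_self (g (P f))
    have h3 := hg1 _ ⟨_, hbal f hf c hc, rfl⟩
    rw [map_smul, map_smul, smul_eq_mul, ← hc', RCLike.ofReal_re] at h3
    exact h3.le)
  rw [← hg] at h1
  exact absurd (hg2.trans_le (RCLike.re_le_norm _)) (not_lt.2 h1)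

/-- A continuous functional on the space of distributions is dominated by a set of test functions
with prescribed bounds on all derivatives. -/
theorem exists_derivBoundedSet_bound [FiniteDimensional ℝ E]
    (Λ : (𝓓(Ω, 𝕜) →L_c[𝕜] 𝕜) →L[𝕜] 𝕜) :
    ∃ (K : Compacts E) (hK : (K : Set E) ⊆ Ω) (B : ℕ → ℝ), (∀ i, 0 ≤ B i) ∧
      ∀ (S : 𝓓(Ω, 𝕜) →L_c[𝕜] 𝕜) (u : ℝ), 0 < u →
        (∀ f ∈ derivBoundedSet 𝕜 K B, ‖S (TestFunction.ofSupportedInCLM 𝕜 hK f)‖ ≤ u) →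
        ‖Λ S‖ ≤ u := by
  obtain ⟨C, hC, ε, hε, hΛ⟩ := exists_compact_bound Λ
  obtain ⟨K, hK, B, hB0, hCB⟩ := exists_derivBoundedSet_superset hC
  -- The factor `2 / ε` turns the bound `u` into `ε / 2` for `u⁻¹ • S` on `C`, which gives the
  -- strict inequality required by `hΛ`.
  refine ⟨K, hK, fun i => (2 / ε) * B i, fun i => mul_nonneg (by positivity) (hB0 i), ?_⟩
  intro S u hu hS
  have h1 := hΛ (((u : 𝕜)⁻¹) • S) (by
    intro φ hφ
    obtain ⟨f, hf, rfl⟩ := hCB hφ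
    have h2 := smul_mem_derivBoundedSet hf ((2 / ε : ℝ) : 𝕜)
    rw [RCLike.norm_ofReal, abs_of_pos (by positivity)] at h2
    have h3 := hS _ h2
    rw [map_smul, map_smul, smul_eq_mul, norm_mul, RCLike.norm_ofReal,
      abs_of_pos (by positivity)] at h3
    rw [TestFunction.coe_ofSupportedInCLM] at h3
    have h4 : (((u : 𝕜)⁻¹) • S) (TestFunction.ofSupportedIn hK f) =
        (u : 𝕜)⁻¹ • S (TestFunction.ofSupportedIn hK f) := rfl
    rw [h4, norm_smul, norm_inv, RCLike.norm_ofReal, abs_of_pos hu, inv_mul_lt_iff₀ hu]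
    generalize ‖S (TestFunction.ofSupportedIn hK f)‖ = y at h3
    have h5 : y ≤ u * ε / 2 := by
      rw [le_div_iff₀ two_pos]
      rw [div_mul_eq_mul_div, div_le_iff₀ hε] at h3
      linarith
    have h6 : 0 < u * ε := by positivity
    linarith)
  rw [map_smul, norm_smul, norm_inv, RCLike.norm_ofReal, abs_of_pos hu, inv_mul_lt_iff₀ hu,
    mul_one] at h1
  exact h1.le

/-- The dual of the space of distributions, with the topology of compact convergence, is the space
of test functions. -/
theorem exists_testFunction_of_continuous [FiniteDimensional ℝ E]
    (Λ : (𝓓(Ω, 𝕜) →L_c[𝕜] 𝕜) →L[𝕜] 𝕜) :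
    ∃ ψ : 𝓓(Ω, 𝕜), ∀ S : 𝓓(Ω, 𝕜) →L_c[𝕜] 𝕜, Λ S = S ψ := by
  obtain ⟨K, hK, B, hB0, hΛ⟩ := exists_derivBoundedSet_bound Λ
  have hΓc : IsCompact (derivBoundedSet 𝕜 K B) := isCompact_derivBoundedSet K _
  -- Each distribution imposes a closed condition on `f`. Finitely many conditions can be met inside
  -- the compact set, hence all of them can.
  obtain ⟨f, -, hf⟩ := hΓc.inter_iInter_nonempty
    (fun S : 𝓓(Ω, 𝕜) →L_c[𝕜] 𝕜 => {f | S (TestFunction.ofSupportedInCLM 𝕜 hK f) = Λ S})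
    (fun S => isClosed_eq ((map_continuous S).comp
      (TestFunction.ofSupportedInCLM 𝕜 hK).continuous) continuous_const) (by
      intro t
      obtain ⟨f, hf, hft⟩ := exists_mem_forall_apply_eq hΓc (convex_derivBoundedSet K B)
        (zero_mem_derivBoundedSet hB0)
        (fun f hf c hc => by simpa [hc] using smul_mem_derivBoundedSet hf c)
        (fun S : t => (show 𝓓(Ω, 𝕜) →L[𝕜] 𝕜 from S.1).comp (TestFunction.ofSupportedInCLM 𝕜 hK))
        (fun S : t => Λ S.1) (by
          intro c u hu hS
          have h1 := hΛ (∑ i : t, c i • i.1) u hu (by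
            intro f hf
            have h2 := hS f hf
            have h3 : (∑ i : t, c i • i.1 : 𝓓(Ω, 𝕜) →L_c[𝕜] 𝕜)
                (TestFunction.ofSupportedInCLM 𝕜 hK f) =
                ∑ i : t, c i * i.1 (TestFunction.ofSupportedInCLM 𝕜 hK f) := by
              rw [sum_apply]
              rfl
            rw [h3]
            exact h2)
          simpa only [map_sum, map_smul, smul_eq_mul] using h1)
      exact ⟨f, hf, Set.mem_iInter₂.2 fun S hS => hft ⟨S, hS⟩⟩)
  exact ⟨TestFunction.ofSupportedInCLM 𝕜 hK f, fun S => (Set.mem_iInter.1 hf S).symm⟩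

end Duality

/-! ### Interchanging distributions and integrals. -/

section WeakIntegral

open Filter Topology

variable {𝕜 E : Type*} [RCLike 𝕜] [NormedAddCommGroup E] [NormedSpace ℝ E] {Ω : Opens E}

/-- The evaluation at a point, as a distribution. -/
def diracDistribution (𝕜 : Type*) [RCLike 𝕜] (Ω : Opens E) (x : E) : 𝓓(Ω, 𝕜) →L_c[𝕜] 𝕜 :=
  ({ toFun := fun φ => φ x
     map_add' := fun _ _ => rfl
     map_smul' := fun _ _ => rfl
     cont := continuous_eval_const x } : 𝓓(Ω, 𝕜) →L[𝕜] 𝕜)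

/-- Continuity of a linear functional on distributions which is dominated by the supremum over a
compact set of test functions. -/
theorem continuous_of_compact_bound (Λ : (𝓓(Ω, 𝕜) →L_c[𝕜] 𝕜) →ₗ[𝕜] 𝕜) {C : Set 𝓓(Ω, 𝕜)}
    (hC : IsCompact C) (c : ℝ)
    (h : ∀ (S : 𝓓(Ω, 𝕜) →L_c[𝕜] 𝕜) (u : ℝ), 0 ≤ u → (∀ φ ∈ C, ‖S φ‖ ≤ u) → ‖Λ S‖ ≤ c * u) :
    Continuous Λ := by
  refine continuous_of_continuousAt_zero Λ ?_
  rw [ContinuousAt, map_zero, Metric.nhds_basis_ball.tendsto_right_iff]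
  intro ε hε
  refine (CompactConvergenceCLM.hasBasis_nhds_zero_of_basis (σ := RingHom.id 𝕜)
      (E := 𝓓(Ω, 𝕜)) (F := 𝕜) Metric.nhds_basis_ball).mem_iff.2
    ⟨(C, ε / (|c| + 1)), ⟨hC, by positivity⟩, fun S hS => ?_⟩
  have h1 := h S (ε / (|c| + 1)) (by positivity) (fun φ hφ => by
    exact (mem_ball_zero_iff.1 (hS φ hφ)).le)
  simp only [Metric.mem_ball, dist_zero_right]
  refine h1.trans_lt ?_
  rw [← mul_div_assoc, div_lt_iff₀ (by positivity)]
  nlinarith [le_abs_self c]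

/-- The weak integral of a continuous family of test functions over a compact set. -/
theorem exists_weak_integral [FiniteDimensional ℝ E] {Y : Type*} [TopologicalSpace Y] [T2Space Y]
    [MeasurableSpace Y] [OpensMeasurableSpace Y] (μ : Measure Y) [IsFiniteMeasureOnCompacts μ]
    {κ : Set Y} (hκ : IsCompact κ) {γ : Y → 𝓓(Ω, 𝕜)} (hγ : ContinuousOn γ κ) :
    ∃ g : 𝓓(Ω, 𝕜), ∀ S : 𝓓(Ω, 𝕜) →L_c[𝕜] 𝕜, S g = ∫ y in κ, S (γ y) ∂μ := by
  have hInt : ∀ S : 𝓓(Ω, 𝕜) →L_c[𝕜] 𝕜, IntegrableOn (fun y => S (γ y)) κ μ := fun S =>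
    ((map_continuous S).comp_continuousOn hγ).integrableOn_compact hκ
  let Λ : (𝓓(Ω, 𝕜) →L_c[𝕜] 𝕜) →ₗ[𝕜] 𝕜 :=
    { toFun := fun S => ∫ y in κ, S (γ y) ∂μ
      map_add' := fun S T => integral_add (hInt S) (hInt T)
      map_smul' := fun c S => integral_const_mul c _ }
  have hΛ : Continuous Λ := continuous_of_compact_bound Λ (hκ.image_of_continuousOn hγ)
    (μ.real κ) (by
      intro S u hu hS
      rw [mul_comm]
      exact norm_setIntegral_le_of_norm_le_const hκ.measure_lt_top
        fun y hy => hS _ ⟨y, hy, rfl⟩)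
  obtain ⟨g, hg⟩ := exists_testFunction_of_continuous ⟨Λ, hΛ⟩
  exact ⟨g, fun S => (hg S).symm⟩

/-- A test function which is pointwise the integral of a continuous family of test functions is
the weak integral of that family. -/
theorem apply_eq_setIntegral_of_forall [FiniteDimensional ℝ E] {Y : Type*} [TopologicalSpace Y]
    [T2Space Y] [MeasurableSpace Y] [OpensMeasurableSpace Y] (μ : Measure Y)
    [IsFiniteMeasureOnCompacts μ]
    {κ : Set Y} (hκ : IsCompact κ) {γ : Y → 𝓓(Ω, 𝕜)} (hγ : ContinuousOn γ κ)
    {g : 𝓓(Ω, 𝕜)} (hg : ∀ x, g x = ∫ y in κ, γ y x ∂μ) (S : 𝓓(Ω, 𝕜) →L_c[𝕜] 𝕜) :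
    S g = ∫ y in κ, S (γ y) ∂μ := by
  obtain ⟨g', hg'⟩ := exists_weak_integral μ hκ hγ
  have : g = g' := by
    ext x
    rw [hg]
    exact (hg' (diracDistribution 𝕜 Ω x)).symm
  rw [this, hg']

end WeakIntegral

/-! ### Distributions applied to smooth families of test functions. -/

section Families

open Filter Topology
open scoped ContDiff

variable {𝕜 E P : Type*} [RCLike 𝕜] [NormedAddCommGroup E] [NormedSpace ℝ E]
  [NormedAddCommGroup P] [NormedSpace ℝ P] {Ω : Opens E} {K : Compacts E}

/-- Smooth functions of two variables which are supported in `K` in the first one. -/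
structure IsTestFamily (K : Compacts E) (F : E × P → 𝕜) : Prop where
  contDiff : ContDiff ℝ ∞ F
  zero_off : ∀ x ∉ K, ∀ p, F (x, p) = 0

namespace IsTestFamily

variable {F G : E × P → 𝕜}

/-- The test functions `F (·, p)` of a family. -/
def slice (hF : IsTestFamily K F) (p : P) : 𝓓_{K}(E, 𝕜) where
  toFun x := F (x, p)
  contDiff' := hF.contDiff.comp (contDiff_id.prodMk contDiff_const)
  zero_on_compl' x hx := hF.zero_off x hx p

@[simp]
theorem slice_apply (hF : IsTestFamily K F) (p : P) (x : E) : hF.slice p x = F (x, p) := rfl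

theorem iteratedFDeriv_slice (hF : IsTestFamily K F) (p : P) (i : ℕ) (x : E) :
    iteratedFDeriv ℝ i (hF.slice p) x =
      (iteratedFDeriv ℝ i F (x, p)).compContinuousLinearMap
        fun _ => ContinuousLinearMap.inl ℝ E P := by
  have h1 : (hF.slice p : E → 𝕜) = (fun z => F (z + (0, p))) ∘ ContinuousLinearMap.inl ℝ E P := by
    ext y
    simp
  rw [h1, ContinuousLinearMap.iteratedFDeriv_comp_right (n := ∞) (ContinuousLinearMap.inl ℝ E P)
    (f := fun z : E × P => F (z + (0, p))) (hF.contDiff.comp (contDiff_id.add contDiff_const)) x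
    (mod_cast le_top),
    iteratedFDeriv_comp_add_right]
  simp

theorem norm_iteratedFDeriv_slice_le (hF : IsTestFamily K F) (p : P) (i : ℕ) (x : E) :
    ‖iteratedFDeriv ℝ i (hF.slice p) x‖ ≤ ‖iteratedFDeriv ℝ i F (x, p)‖ := by
  rw [hF.iteratedFDeriv_slice]
  refine (ContinuousMultilinearMap.norm_compContinuousLinearMap_le _ _).trans ?_
  refine mul_le_of_le_one_right (norm_nonneg _) (Finset.prod_le_one (fun _ _ => norm_nonneg _) ?_)
  exact fun _ _ => ContinuousLinearMap.norm_inl_le_one ℝ E P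

theorem continuous_slice (hF : IsTestFamily K F) : Continuous hF.slice := by
  rw [ContDiffMapSupportedIn.continuous_iff_comp]
  intro i
  rw [continuous_iff_continuousAt]
  intro p₀
  rw [ContinuousAt, BoundedContinuousFunction.tendsto_iff_tendstoUniformly,
    Metric.tendstoUniformly_iff]
  intro ε hε
  have hcont : Continuous (Function.uncurry fun (p : P) (x : E) =>
      iteratedFDeriv ℝ i (hF.slice p) x) := by
    have h1 : (Function.uncurry fun (p : P) (x : E) => iteratedFDeriv ℝ i (hF.slice p) x) =
        fun z : P × E => ContinuousMultilinearMap.compContinuousLinearMapL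
          (fun _ => ContinuousLinearMap.inl ℝ E P) (iteratedFDeriv ℝ i F (z.2, z.1)) := by
      ext1 z
      exact hF.iteratedFDeriv_slice z.1 i z.2
    rw [h1]
    exact (ContinuousLinearMap.continuous _).comp
      ((hF.contDiff.continuous_iteratedFDeriv (mod_cast le_top)).comp continuous_swap)
  obtain ⟨v, hv, h⟩ := K.isCompact.mem_uniformity_of_prod (hcont.continuousOn (s := Set.univ ×ˢ K))
    (Set.mem_univ p₀) (Metric.dist_mem_uniformity hε)
  rw [nhdsWithin_univ] at hv
  filter_upwards [hv] with p hp x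
  rw [Function.comp_apply, Function.comp_apply, ContDiffMapSupportedIn.structureMapCLM_top_apply,
    ContDiffMapSupportedIn.structureMapCLM_top_apply]
  by_cases hx : x ∈ K
  · rw [dist_comm]
    exact h p hp x hx
  · rw [ContDiffMapSupportedIn.iteratedFDeriv_zero_on_compl _ hx,
      ContDiffMapSupportedIn.iteratedFDeriv_zero_on_compl _ hx]
    simpa using hε

/-- The derivative of a family in the direction of a parameter. -/
def paramDeriv (F : E × P → 𝕜) (v : P) (z : E × P) : 𝕜 := fderiv ℝ F z (0, v)

theorem isTestFamily_paramDeriv (hF : IsTestFamily K F) (v : P) :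
    IsTestFamily K (paramDeriv F v) where
  contDiff := (hF.contDiff.fderiv_right (m := ∞) (mod_cast le_rfl)).clm_apply contDiff_const
  zero_off x hx p := by
    have h1 : F =ᶠ[𝓝 (x, p)] 0 := by
      have : {z : E × P | z.1 ∉ K} ∈ 𝓝 (x, p) :=
        (K.isCompact.isClosed.isOpen_compl.preimage continuous_fst).mem_nhds hx
      filter_upwards [this] with z hz
      exact hF.zero_off z.1 hz z.2
    rw [paramDeriv, h1.fderiv_eq]
    simp

theorem hasDerivAt_line (hF : IsTestFamily K F) (x : E) (p v : P) (t : ℝ) :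
    HasDerivAt (fun t : ℝ => F (x, p + t • v)) (paramDeriv F v (x, p + t • v)) t := by
  have h1 := (hF.contDiff.differentiable (by simp) (x, p + t • v)).hasFDerivAt
  have h2 : HasDerivAt (fun t : ℝ => ((x, p + t • v) : E × P)) (0, v) t := by
    have := ((hasDerivAt_id t).smul_const v).const_add p
    simpa using (hasDerivAt_const t x).prodMk this
  exact h1.comp_hasDerivAt t h2

variable (T : 𝓓(Ω, 𝕜) →L_c[𝕜] 𝕜) (hK : (K : Set E) ⊆ Ω)

/-- A distribution applied to the test functions of a family. -/
def pairing (hF : IsTestFamily K F) (p : P) : 𝕜 :=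
  T (TestFunction.ofSupportedIn hK (hF.slice p))

theorem continuous_pairing (hF : IsTestFamily K F) : Continuous (hF.pairing T hK) :=
  (map_continuous T).comp ((TestFunction.continuous_ofSupportedIn hK).comp hF.continuous_slice)

/-- The fundamental theorem of calculus holds for each fixed `x`, and weak integration carries it
through `T`. -/
theorem pairing_add_sub_pairing [FiniteDimensional ℝ E] (hF : IsTestFamily K F) (p v : P) :
    hF.pairing T hK (p + v) - hF.pairing T hK p =
      ∫ t in Set.Icc (0 : ℝ) 1, (hF.isTestFamily_paramDeriv v).pairing T hK (p + t • v) := by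
  have hl : Continuous fun t : ℝ => p + t • v := by fun_prop
  have h := apply_eq_setIntegral_of_forall volume (κ := Set.Icc (0 : ℝ) 1) isCompact_Icc
    (γ := fun t : ℝ => TestFunction.ofSupportedIn hK
      ((hF.isTestFamily_paramDeriv v).slice (p + t • v)))
    (((TestFunction.continuous_ofSupportedIn hK).comp
      ((hF.isTestFamily_paramDeriv v).continuous_slice.comp hl)).continuousOn)
    (g := TestFunction.ofSupportedIn hK (hF.slice (p + v)) -
      TestFunction.ofSupportedIn hK (hF.slice p)) (by
      intro x
      have h1 := intervalIntegral.integral_eq_sub_of_hasDerivAt (a := 0) (b := 1)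
        (fun t _ => hF.hasDerivAt_line x p v t)
        ((((hF.isTestFamily_paramDeriv v).contDiff.continuous.comp
          (continuous_const.prodMk hl))).intervalIntegrable _ _)
      rw [intervalIntegral.integral_of_le zero_le_one, ← integral_Icc_eq_integral_Ioc] at h1
      simp only [one_smul, zero_smul, add_zero] at h1
      exact h1.symm) T
  rw [map_sub] at h
  exact h

/-- The derivative of the pairing of a distribution with a family. -/
def pairingDeriv [FiniteDimensional ℝ P] (hF : IsTestFamily K F) (p : P) : P →L[ℝ] 𝕜 :=
  LinearMap.toContinuousLinearMap
    { toFun := fun v => (hF.isTestFamily_paramDeriv v).pairing T hK p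
      map_add' := fun v w => by
        rw [pairing, pairing, pairing, ← map_add]
        congr 1
        ext x
        change fderiv ℝ F (x, p) (0, v + w) =
          fderiv ℝ F (x, p) (0, v) + fderiv ℝ F (x, p) (0, w)
        rw [← map_add]
        simp
      map_smul' := fun c v => by
        rw [pairing, pairing, RingHom.id_apply, RCLike.real_smul_eq_coe_mul, ← smul_eq_mul,
          ← map_smul]
        congr 1
        ext x
        change fderiv ℝ F (x, p) (0, c • v) = (c : 𝕜) * fderiv ℝ F (x, p) (0, v)
        rw [← RCLike.real_smul_eq_coe_mul, ← map_smul]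
        simp }

@[simp]
theorem pairingDeriv_apply [FiniteDimensional ℝ P] (hF : IsTestFamily K F) (p v : P) :
    hF.pairingDeriv T hK p v = (hF.isTestFamily_paramDeriv v).pairing T hK p := rfl

theorem hasFDerivAt_pairing [FiniteDimensional ℝ E] [FiniteDimensional ℝ P]
    (hF : IsTestFamily K F) (p : P) :
    HasFDerivAt (hF.pairing T hK) (hF.pairingDeriv T hK p) p := by
  have hcont : Continuous (hF.pairingDeriv T hK) := by
    rw [continuous_clm_apply]
    exact fun v => (hF.isTestFamily_paramDeriv v).continuous_pairing T hK
  rw [hasFDerivAt_iff_isLittleO_nhds_zero, Asymptotics.isLittleO_iff]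
  intro ε hε
  obtain ⟨δ, hδ, hball⟩ := Metric.continuousAt_iff.1 hcont.continuousAt ε hε
  filter_upwards [Metric.ball_mem_nhds (0 : P) hδ] with v hv
  rw [mem_ball_zero_iff] at hv
  rw [pairing_add_sub_pairing]
  have hl : Continuous fun t : ℝ => p + t • v := by fun_prop
  have h1 : ∫ t in Set.Icc (0 : ℝ) 1, hF.pairingDeriv T hK p v = hF.pairingDeriv T hK p v := by
    simp
  rw [← h1, ← integral_sub
    (f := fun t : ℝ => (hF.isTestFamily_paramDeriv v).pairing T hK (p + t • v))
    ((((hF.isTestFamily_paramDeriv v).continuous_pairing T hK).comp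
      hl).continuousOn.integrableOn_compact isCompact_Icc)
    (continuous_const.continuousOn.integrableOn_compact isCompact_Icc)]
  have h2 := norm_setIntegral_le_of_norm_le_const (μ := volume) (s := Set.Icc (0 : ℝ) 1)
    (f := fun t : ℝ => (hF.isTestFamily_paramDeriv v).pairing T hK (p + t • v) -
      hF.pairingDeriv T hK p v) (C := ε * ‖v‖) (by simp) (by
      intro t ht
      rw [← pairingDeriv_apply, ← sub_apply]
      refine ContinuousLinearMap.le_of_opNorm_le _ ?_ v
      rw [← dist_eq_norm]
      refine (hball ?_).le
      rw [dist_eq_norm, add_sub_cancel_left, norm_smul, Real.norm_of_nonneg ht.1]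
      exact (mul_le_of_le_one_left (norm_nonneg _) ht.2).trans_lt hv)
  simpa using h2

/-- A directional derivative of a pairing is the pairing with another test family, so smoothness
follows by induction on the order. -/
theorem contDiff_pairing [FiniteDimensional ℝ E] [FiniteDimensional ℝ P]
    (hF : IsTestFamily K F) : ContDiff ℝ ∞ (hF.pairing T hK) := by
  rw [contDiff_infty]
  intro n
  induction n generalizing F with
  | zero => exact contDiff_zero.2 (hF.continuous_pairing T hK)
  | succ n ih =>
    have hd := hF.hasFDerivAt_pairing T hK
    rw [Nat.cast_add, Nat.cast_one, contDiff_succ_iff_fderiv]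
    refine ⟨fun p => (hd p).differentiableAt, by simp, ?_⟩
    rw [funext fun p => (hd p).fderiv, contDiff_clm_apply_iff]
    exact fun v => ih (hF.isTestFamily_paramDeriv v)

theorem norm_iteratedFDeriv_paramDeriv_le (hF : IsTestFamily K F) (v : P) (i : ℕ) (z : E × P) :
    ‖iteratedFDeriv ℝ i (paramDeriv F v) z‖ ≤ ‖iteratedFDeriv ℝ (i + 1) F z‖ * ‖v‖ := by
  have h1 := norm_iteratedFDeriv_clm_apply_const (𝕜 := ℝ) (f := fderiv ℝ F) (c := ((0 : E), v))
    (x := z) (N := ∞) (n := i)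
    (hF.contDiff.fderiv_right (m := ∞) (mod_cast le_rfl)).contDiffAt (mod_cast le_top)
  rw [norm_iteratedFDeriv_fderiv] at h1
  refine h1.trans ?_
  rw [mul_comm]
  simp

theorem exists_norm_le_of_supportedIn : ∃ (m : ℕ) (C : ℝ), 0 ≤ C ∧ ∀ (f : 𝓓_{K}(E, 𝕜)) (M : ℝ),
    (∀ k ≤ m, ∀ x, ‖iteratedFDeriv ℝ k f x‖ ≤ M) →
      ‖T (TestFunction.ofSupportedIn hK f)‖ ≤ C * M := by
  let Λ : 𝓓_{K}(E, 𝕜) →L[𝕜] 𝕜 :=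
    (show 𝓓(Ω, 𝕜) →L[𝕜] 𝕜 from T).comp (TestFunction.ofSupportedInCLM 𝕜 hK)
  obtain ⟨s, C, -, h⟩ := Seminorm.bound_of_continuous
    (ContDiffMapSupportedIn.withSeminorms 𝕜 E 𝕜 ⊤ K)
    ((normSeminorm 𝕜 𝕜).comp (Λ : 𝓓_{K}(E, 𝕜) →ₗ[𝕜] 𝕜)) Λ.continuous.norm
  refine ⟨s.sup id, C, C.2, fun f M hM => (h f).trans ?_⟩
  have hM0 : 0 ≤ M := (norm_nonneg _).trans (hM 0 (Nat.zero_le _) 0)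
  refine mul_le_mul_of_nonneg_left (Seminorm.finset_sup_apply_le hM0 fun k hk => ?_) C.2
  rw [ContDiffMapSupportedIn.seminorm_top_le_iff _ hM0]
  exact fun x _ => hM k (Finset.le_sup (f := id) hk) x

/-- The point is that `m` and `C` do not depend on the family: this uniformity yields continuity in
`φ` of `y ↦ T_x φ(xy)`. Each parameter derivative costs one more derivative of `F`. -/
theorem exists_norm_iteratedFDeriv_pairing_le [FiniteDimensional ℝ E] [FiniteDimensional ℝ P]
    (i : ℕ) : ∃ (m : ℕ) (C : ℝ), 0 ≤ C ∧ ∀ (F : E × P → 𝕜) (hF : IsTestFamily K F) (p : P) (M : ℝ),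
      (∀ k ≤ m, ∀ x, ‖iteratedFDeriv ℝ k F (x, p)‖ ≤ M) →
        ‖iteratedFDeriv ℝ i (hF.pairing T hK) p‖ ≤ C * M := by
  induction i with
  | zero =>
    obtain ⟨m, C, hC, h⟩ := exists_norm_le_of_supportedIn T hK
    refine ⟨m, C, hC, fun F hF p M hM => ?_⟩
    rw [norm_iteratedFDeriv_zero]
    exact h _ M fun k hk x => (hF.norm_iteratedFDeriv_slice_le p k x).trans (hM k hk x)
  | succ i ih =>
    obtain ⟨m, C, hC, h⟩ := ih
    refine ⟨m + 1, C, hC, fun F hF p M hM => ?_⟩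
    have hM0 : 0 ≤ M := (norm_nonneg _).trans (hM 0 (Nat.zero_le _) 0)
    have hd := hF.hasFDerivAt_pairing T hK
    have hsm : ContDiff ℝ ∞ (hF.pairingDeriv T hK) := by
      rw [contDiff_clm_apply_iff]
      exact fun v => (hF.isTestFamily_paramDeriv v).contDiff_pairing T hK
    rw [← norm_iteratedFDeriv_fderiv, funext fun p => (hd p).fderiv]
    refine ContinuousMultilinearMap.opNorm_le_bound (by positivity) fun w => ?_
    refine ContinuousLinearMap.opNorm_le_bound _ (by positivity) fun v => ?_
    have h1 : iteratedFDeriv ℝ i (hF.pairingDeriv T hK) p w v =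
        iteratedFDeriv ℝ i ((hF.isTestFamily_paramDeriv v).pairing T hK) p w :=
      (iteratedFDeriv_clm_apply_const_apply hsm (mod_cast le_top)).symm
    rw [h1]
    refine (ContinuousMultilinearMap.le_opNorm _ _).trans ?_
    have h2 := h _ (hF.isTestFamily_paramDeriv v) p (M * ‖v‖) (fun k hk x =>
      (hF.norm_iteratedFDeriv_paramDeriv_le v k (x, p)).trans
        (mul_le_mul_of_nonneg_right (hM (k + 1) (by lia) x) (norm_nonneg _)))
    calc _ ≤ C * (M * ‖v‖) * ∏ i, ‖w i‖ := by gcongr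
      _ = _ := by ring

end IsTestFamily

end Families

/-! ### The families of cut-off dilations and their derivative bounds. -/

section MulFamily

open Filter Topology
open scoped ContDiff

variable {𝕜 E : Type*} [RCLike 𝕜] [NormedAddCommGroup E] [NormedSpace ℝ E] {Ω₁ Ω₂ : Opens E}

/-- The compact support of a test function. -/
def TestFunction.support (φ : 𝓓(Ω₁, 𝕜)) : Compacts E := ⟨tsupport φ, φ.hasCompactSupport⟩

theorem TestFunction.support_subset (φ : 𝓓(Ω₁, 𝕜)) : (φ.support : Set E) ⊆ Ω₁ := φ.tsupport_subset

theorem TestFunction.eq_zero_of_notMem_support (φ : 𝓓(Ω₁, 𝕜)) {x : E} (hx : x ∉ φ.support) :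
    φ x = 0 := image_eq_zero_of_notMem_tsupport hx

theorem TestFunction.eq_zero_of_notMem (φ : 𝓓(Ω₁, 𝕜)) {x : E} (hx : x ∉ Ω₁) : φ x = 0 :=
  image_eq_zero_of_notMem_tsupport fun h => hx (φ.tsupport_subset h)

/-- A linear map between spaces of test functions which is locally bounded in the seminorms is
continuous. -/
def TestFunction.mkCLMOfBounds (A : 𝓓(Ω₁, 𝕜) → 𝓓(Ω₂, 𝕜)) (hadd : ∀ f g, A (f + g) = A f + A g)
    (hsmul : ∀ (c : 𝕜) f, A (c • f) = c • A f)
    (h : ∀ (K : Compacts E) (hK : (K : Set E) ⊆ Ω₁), ∃ Q : Compacts E, (Q : Set E) ⊆ Ω₂ ∧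
      (∀ f : 𝓓_{K}(E, 𝕜), Set.EqOn (A (TestFunction.ofSupportedIn hK f)) 0 (Q : Set E)ᶜ) ∧
      ∀ i : ℕ, ∃ (m : ℕ) (C : ℝ), 0 ≤ C ∧ ∀ (f : 𝓓_{K}(E, 𝕜)) (M : ℝ),
        (∀ k ≤ m, ∀ x, ‖iteratedFDeriv ℝ k f x‖ ≤ M) →
          ∀ x ∈ Q, ‖iteratedFDeriv ℝ i (A (TestFunction.ofSupportedIn hK f)) x‖ ≤ C * M) :
    𝓓(Ω₁, 𝕜) →L[𝕜] 𝓓(Ω₂, 𝕜) :=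
  TestFunction.mkCLM 𝕜 A hadd hsmul (by
    intro K hK
    obtain ⟨Q, hQ, hsupp, hb⟩ := h K hK
    let Φ : 𝓓_{K}(E, 𝕜) →L[𝕜] 𝓓_{Q}(E, 𝕜) := ContDiffMapSupportedIn.mkCLM 𝕜
      (fun f => A (TestFunction.ofSupportedIn hK f))
      (fun f g x => by
        change A (TestFunction.ofSupportedIn hK f + TestFunction.ofSupportedIn hK g) x = _
        rw [hadd]
        rfl)
      (fun c f x => by
        change A (c • TestFunction.ofSupportedIn hK f) x = _
        rw [hsmul]
        rfl)
      (fun f => (A (TestFunction.ofSupportedIn hK f)).contDiff) hsupp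
      (fun i _ => by
        obtain ⟨m, C, hC, hm⟩ := hb i
        refine ⟨Finset.range (m + 1), C, hC, fun f x hx => hm f _ (fun k hk x => ?_) x hx⟩
        refine (ContDiffMapSupportedIn.norm_iteratedFDeriv_apply_le_seminorm_top 𝕜).trans ?_
        exact Seminorm.le_finset_sup_apply (Finset.mem_range.2 (Nat.lt_succ_of_le hk)))
    have h1 : A ∘ TestFunction.ofSupportedIn hK = TestFunction.ofSupportedIn hQ ∘ Φ := by
      ext f x
      rfl
    rw [h1]
    exact (TestFunction.continuous_ofSupportedIn hQ).comp Φ.continuous)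

@[simp]
theorem TestFunction.mkCLMOfBounds_apply (A : 𝓓(Ω₁, 𝕜) → 𝓓(Ω₂, 𝕜)) (hadd hsmul h) (f : 𝓓(Ω₁, 𝕜)) :
    TestFunction.mkCLMOfBounds A hadd hsmul h f = A f := rfl

/-- Requiring `1 ≤ A` lets `A` be replaced by its positive powers, the form in which the chain rule
estimate asks for bounds on the inner function. -/
theorem exists_bound_iteratedFDeriv {X G : Type*} [NormedAddCommGroup X] [NormedSpace ℝ X]
    [NormedAddCommGroup G] [NormedSpace ℝ G] {g : X → G} (hg : ContDiff ℝ ∞ g) {Q : Set X}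
    (hQ : IsCompact Q) (m : ℕ) :
    ∃ A : ℝ, 1 ≤ A ∧ ∀ k ≤ m, ∀ z ∈ Q, ‖iteratedFDeriv ℝ k g z‖ ≤ A := by
  have h : ∀ k : ℕ, ∃ A : ℝ, ∀ z ∈ Q, ‖iteratedFDeriv ℝ k g z‖ ≤ A := fun k =>
    hQ.exists_bound_of_continuousOn (hg.continuous_iteratedFDeriv (mod_cast le_top)).continuousOn
  choose A hA using h
  refine ⟨1 + ∑ k ∈ Finset.range (m + 1), |A k|, by simp; positivity, fun k hk z hz => ?_⟩
  calc ‖iteratedFDeriv ℝ k g z‖ ≤ |A k| := (hA k z hz).trans (le_abs_self _)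
    _ ≤ ∑ k ∈ Finset.range (m + 1), |A k| :=
      Finset.single_le_sum (f := fun k => |A k|) (fun _ _ => abs_nonneg _)
        (Finset.mem_range.2 (Nat.lt_succ_of_le hk))
    _ ≤ _ := by linarith

variable {d : ℕ} {O₁ O₂ : Opens (Fin d → ℝ)}

/-- The function `(x, y) ↦ χ x * φ (x * y)`. -/
def mulFamily (χ φ : (Fin d → ℝ) → 𝕜) (z : (Fin d → ℝ) × (Fin d → ℝ)) : 𝕜 := χ z.1 * φ (z.1 * z.2)

theorem isTestFamily_mulFamily (χ : 𝓓(O₂, 𝕜)) {φ : (Fin d → ℝ) → 𝕜} (hφ : ContDiff ℝ ∞ φ) :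
    IsTestFamily χ.support (mulFamily χ φ) where
  contDiff := (χ.contDiff.comp contDiff_fst).mul (hφ.comp (contDiff_fst.mul contDiff_snd))
  zero_off x hx p := by rw [mulFamily, χ.eq_zero_of_notMem_support hx, zero_mul]

theorem iteratedFDeriv_mulFamily_eq_zero (χ φ : (Fin d → ℝ) → 𝕜) (k : ℕ)
    {x : Fin d → ℝ} (hx : x ∉ tsupport χ) (y : Fin d → ℝ) :
    iteratedFDeriv ℝ k (mulFamily χ φ) (x, y) = 0 := by
  have h1 : mulFamily χ φ =ᶠ[𝓝 (x, y)] fun _ => 0 := by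
    have : {z : (Fin d → ℝ) × (Fin d → ℝ) | z.1 ∉ tsupport χ} ∈ 𝓝 (x, y) :=
      ((isClosed_tsupport χ).isOpen_compl.preimage continuous_fst).mem_nhds hx
    filter_upwards [this] with z hz
    rw [mulFamily, image_eq_zero_of_notMem_tsupport hz, zero_mul]
  rw [(h1.iteratedFDeriv (𝕜 := ℝ) k).eq_of_nhds]
  simp [iteratedFDeriv_fun_zero]

/-- Leibniz and higher chain rule estimates, with constants from the compact set `tsupport χ ×ˢ κ`;
off the support of `χ` the family vanishes. -/
theorem exists_norm_iteratedFDeriv_mulFamily_le (χ : 𝓓(O₂, 𝕜)) {κ : Set (Fin d → ℝ)}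
    (hκ : IsCompact κ) (m : ℕ) : ∃ C : ℝ, 0 ≤ C ∧ ∀ φ : (Fin d → ℝ) → 𝕜, ContDiff ℝ ∞ φ → ∀ M : ℝ,
      (∀ k ≤ m, ∀ x, ‖iteratedFDeriv ℝ k φ x‖ ≤ M) → ∀ k ≤ m, ∀ x, ∀ y ∈ κ,
        ‖iteratedFDeriv ℝ k (mulFamily χ φ) (x, y)‖ ≤ C * M := by
  have hQ : IsCompact (tsupport χ ×ˢ κ) := χ.hasCompactSupport.isCompact.prod hκ
  have hμ : ContDiff ℝ ∞ fun z : (Fin d → ℝ) × (Fin d → ℝ) => z.1 * z.2 :=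
    contDiff_fst.mul contDiff_snd
  have hχ : ContDiff ℝ ∞ fun z : (Fin d → ℝ) × (Fin d → ℝ) => χ z.1 :=
    χ.contDiff.comp contDiff_fst
  obtain ⟨D, hD1, hD⟩ := exists_bound_iteratedFDeriv hμ hQ m
  obtain ⟨A, hA1, hA⟩ := exists_bound_iteratedFDeriv hχ hQ m
  have hD0 : 0 ≤ D := zero_le_one.trans hD1
  have hA0 : 0 ≤ A := zero_le_one.trans hA1
  refine ⟨2 ^ m * A * (m.factorial * D ^ m), by positivity, fun φ hφ M hM k hk x y hy => ?_⟩
  have hM0 : 0 ≤ M := (norm_nonneg _).trans (hM 0 (Nat.zero_le _) 0)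
  by_cases hx : x ∈ tsupport χ
  swap
  · rw [iteratedFDeriv_mulFamily_eq_zero _ _ _ hx, norm_zero]
    positivity
  have hz : (x, y) ∈ tsupport χ ×ˢ κ := ⟨hx, hy⟩
  have hcomp : ∀ j ≤ m, ‖iteratedFDeriv ℝ j (fun z : (Fin d → ℝ) × (Fin d → ℝ) => φ (z.1 * z.2))
      (x, y)‖ ≤ m.factorial * D ^ m * M := by
    intro j hj
    have h1 := norm_iteratedFDeriv_comp_le hφ hμ (n := j) (mod_cast le_top) (x, y) (C := M) (D := D)
      (fun i hi => hM i (hi.trans hj) _)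
      (fun i h1i hi => (hD i (hi.trans hj) _ hz).trans (le_self_pow₀ hD1 (by lia)))
    refine h1.trans ?_
    rw [mul_right_comm]
    gcongr
  refine (norm_iteratedFDeriv_mul_le hχ (hφ.comp hμ) (x, y) (n := k) (mod_cast le_top)).trans ?_
  calc _ ≤ ∑ i ∈ Finset.range (k + 1), (k.choose i : ℝ) * A * (m.factorial * D ^ m * M) := by
        refine Finset.sum_le_sum fun i hi => ?_
        gcongr
        · exact hA i (by have := Finset.mem_range.1 hi; lia) _ hz
        · exact hcomp (k - i) (by lia)
    _ = 2 ^ k * A * (m.factorial * D ^ m * M) := by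
        rw [← Finset.sum_mul, ← Finset.sum_mul]
        congr 2
        exact_mod_cast Nat.sum_range_choose k
    _ ≤ 2 ^ m * A * (m.factorial * D ^ m * M) := by
        gcongr
        exact one_le_two
    _ = _ := by ring

/-- The operator `φ ↦ (x ↦ χ x * φ (x * y))` on test functions. -/
def mulDilate (O₁ : Opens (Fin d → ℝ)) (χ : 𝓓(O₂, 𝕜)) (y : Fin d → ℝ) :
    𝓓(O₁, 𝕜) →L[𝕜] 𝓓(O₂, 𝕜) :=
  TestFunction.mkCLMOfBounds
    (fun φ => TestFunction.ofSupportedIn χ.support_subset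
      ((isTestFamily_mulFamily χ φ.contDiff).slice y))
    (fun f g => by
      ext x
      exact mul_add (χ x) (f (x * y)) (g (x * y)))
    (fun c f => by
      ext x
      exact mul_left_comm (χ x) c (f (x * y)))
    (fun K hK => ⟨χ.support, χ.support_subset, fun f x hx => by
        change χ x * f (x * y) = 0
        rw [χ.eq_zero_of_notMem_support hx, zero_mul], fun i => by
      obtain ⟨C, hC, h⟩ := exists_norm_iteratedFDeriv_mulFamily_le χ (isCompact_singleton (x := y)) i
      exact ⟨i, C, hC, fun f M hM x _ =>
        ((isTestFamily_mulFamily χ f.contDiff).norm_iteratedFDeriv_slice_le y i x).trans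
          (h f f.contDiff M hM i le_rfl x y rfl)⟩⟩)

@[simp]
theorem mulDilate_apply (χ : 𝓓(O₂, 𝕜)) (y : Fin d → ℝ) (φ : 𝓓(O₁, 𝕜)) (x : Fin d → ℝ) :
    mulDilate O₁ χ y φ x = χ x * φ (x * y) := rfl

theorem continuous_mulDilate (χ : 𝓓(O₂, 𝕜)) (φ : 𝓓(O₁, 𝕜)) :
    Continuous fun y => mulDilate O₁ χ y φ :=
  (TestFunction.continuous_ofSupportedIn χ.support_subset).comp
    (isTestFamily_mulFamily χ φ.contDiff).continuous_slice

theorem contDiff_mulDilate (χ : 𝓓(O₂, 𝕜)) (φ : 𝓓(O₁, 𝕜)) (T : 𝓓(O₂, 𝕜) →L_c[𝕜] 𝕜) :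
    ContDiff ℝ ∞ fun y => T (mulDilate O₁ χ y φ) :=
  (isTestFamily_mulFamily χ φ.contDiff).contDiff_pairing T χ.support_subset

theorem exists_norm_iteratedFDeriv_mulDilate_le (χ : 𝓓(O₂, 𝕜)) (T : 𝓓(O₂, 𝕜) →L_c[𝕜] 𝕜)
    {κ : Set (Fin d → ℝ)} (hκ : IsCompact κ) (i : ℕ) :
    ∃ (m : ℕ) (C : ℝ), 0 ≤ C ∧ ∀ (φ : 𝓓(O₁, 𝕜)) (M : ℝ),
      (∀ k ≤ m, ∀ x, ‖iteratedFDeriv ℝ k φ x‖ ≤ M) →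
        ∀ y ∈ κ, ‖iteratedFDeriv ℝ i (fun y => T (mulDilate O₁ χ y φ)) y‖ ≤ C * M := by
  obtain ⟨m, C, hC, h⟩ := IsTestFamily.exists_norm_iteratedFDeriv_pairing_le
    (P := Fin d → ℝ) T χ.support_subset i
  obtain ⟨C', hC', h'⟩ := exists_norm_iteratedFDeriv_mulFamily_le χ hκ m
  refine ⟨m, C * C', by positivity, fun φ M hM y hy => ?_⟩
  rw [mul_assoc]
  exact h _ (isTestFamily_mulFamily χ φ.contDiff) y _
    fun k hk x => h' φ φ.contDiff M hM k hk x y hy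

end MulFamily

/-! ### Partitions of unity, cutoffs and supports of distributions. -/

section Partition

open Filter Topology
open scoped ContDiff Manifold

variable {𝕜 E : Type*} [RCLike 𝕜] [NormedAddCommGroup E] [NormedSpace ℝ E] {Ω : Opens E}

theorem contDiff_ofReal_comp {a : E → ℝ} (ha : ContDiff ℝ ∞ a) :
    ContDiff ℝ ∞ fun x => (a x : 𝕜) :=
  (RCLike.ofRealCLM (K := 𝕜)).contDiff.comp ha

/-- The product of a smooth real function and a test function. -/
def TestFunction.realMul (a : E → ℝ) (ha : ContDiff ℝ ∞ a) (f : 𝓓(Ω, 𝕜)) : 𝓓(Ω, 𝕜) where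
  toFun x := (a x : 𝕜) * f x
  contDiff' := (contDiff_ofReal_comp ha).mul f.contDiff
  hasCompactSupport' := f.hasCompactSupport.mul_left
  tsupport_subset' := (tsupport_mul_subset_right).trans f.tsupport_subset

@[simp]
theorem TestFunction.realMul_apply (a : E → ℝ) (ha : ContDiff ℝ ∞ a) (f : 𝓓(Ω, 𝕜)) (x : E) :
    TestFunction.realMul a ha f x = (a x : 𝕜) * f x := rfl

theorem TestFunction.tsupport_realMul_subset (a : E → ℝ) (ha : ContDiff ℝ ∞ a) (f : 𝓓(Ω, 𝕜)) :
    tsupport (TestFunction.realMul a ha f) ⊆ tsupport a ∩ tsupport f := by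
  refine Set.subset_inter (closure_mono fun x hx => ?_) tsupport_mul_subset_right
  intro h
  exact hx (by simp [h])

variable [FiniteDimensional ℝ E]

/-- A test function decomposes subordinately to an open cover of its support. -/
theorem TestFunction.exists_decomposition (f : 𝓓(Ω, 𝕜)) {ι : Type*} (U : ι → Set E)
    (hU : ∀ i, IsOpen (U i)) (hcov : tsupport f ⊆ ⋃ i, U i) :
    ∃ (t : Finset ι) (g : ι → 𝓓(Ω, 𝕜)), f = ∑ i ∈ t, g i ∧
      ∀ i, tsupport (g i) ⊆ U i ∧ tsupport (g i) ⊆ tsupport f := by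
  classical
  have : ProperSpace E := FiniteDimensional.proper ℝ E
  obtain ⟨t, ht⟩ := f.hasCompactSupport.isCompact.elim_finite_subcover U hU hcov
  obtain ⟨ρ, hρ⟩ := SmoothPartitionOfUnity.exists_isSubordinate 𝓘(ℝ, E)
    (isClosed_tsupport f) (fun i : t => U i) (fun i => hU i) (by
      intro x hx
      obtain ⟨i, hi, hxi⟩ := Set.mem_iUnion₂.1 (ht hx)
      exact Set.mem_iUnion.2 ⟨⟨i, hi⟩, hxi⟩)
  have hs : ∀ i, ContDiff ℝ ∞ (ρ i) := fun i => (ρ i).contMDiff.contDiff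
  let g : ι → 𝓓(Ω, 𝕜) := fun i =>
    if h : i ∈ t then TestFunction.realMul (ρ ⟨i, h⟩) (hs _) f else 0
  refine ⟨t, g, ?_, fun i => ?_⟩
  · ext x
    have h1 : (∑ i ∈ t, g i) x = ∑ i ∈ t, g i x := by
      exact map_sum (diracDistribution 𝕜 Ω x) g t
    rw [h1, ← Finset.sum_coe_sort]
    have h2 : ∀ i : t, g i x = (ρ i x : 𝕜) * f x := fun i => by simp [g]
    simp_rw [h2]
    rw [← Finset.sum_mul]
    by_cases hx : x ∈ tsupport f
    · have h3 := ρ.sum_eq_one hx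
      rw [finsum_eq_sum_of_fintype] at h3
      rw [← RCLike.ofReal_sum, h3, RCLike.ofReal_one, one_mul]
    · rw [image_eq_zero_of_notMem_tsupport hx, mul_zero]
  · by_cases h : i ∈ t
    · simp only [g, h, dif_pos]
      have h1 := TestFunction.tsupport_realMul_subset _ (hs ⟨i, h⟩) f
      exact ⟨(h1.trans Set.inter_subset_left).trans (hρ _), h1.trans Set.inter_subset_right⟩
    · have h0 : tsupport ((0 : 𝓓(Ω, 𝕜)) : E → 𝕜) = ∅ := tsupport_eq_empty_iff.2 rfl
      simp only [g, h, dif_neg, not_false_iff, h0, Set.empty_subset, and_self]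

/-- Cutoff functions. -/
theorem TestFunction.exists_eq_one_nhds (𝕜 : Type*) [RCLike 𝕜] {Q : Set E} (hQ : IsCompact Q)
    (hQΩ : Q ⊆ Ω) :
    ∃ χ : 𝓓(Ω, 𝕜), ∃ U : Set E, IsOpen U ∧ Q ⊆ U ∧ ∀ x ∈ U, χ x = 1 := by
  have : ProperSpace E := FiniteDimensional.proper ℝ E
  obtain ⟨Q', hQ', hQQ', hQ'Ω⟩ := exists_compact_between hQ Ω.isOpen hQΩ
  obtain ⟨f, h1, h0, -⟩ := exists_contMDiffMap_one_nhds_of_subset_interior (n := ⊤) 𝓘(ℝ, E)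
    hQ.isClosed hQQ'
  obtain ⟨U, hU, hQU, hUf⟩ := eventually_nhdsSet_iff_exists.1 h1
  have hf : ContDiff ℝ ∞ f := f.contMDiff.contDiff
  have hts : Function.support (fun x => (f x : 𝕜)) ⊆ Q' := by
    intro x hx
    by_contra h
    exact hx (by simp [h0 x h])
  refine ⟨⟨fun x => (f x : 𝕜), contDiff_ofReal_comp hf,
    HasCompactSupport.of_support_subset_isCompact hQ' hts,
    (closure_minimal hts hQ'.isClosed).trans hQ'Ω⟩, U, hU, hQU, fun x hx => ?_⟩
  change ((f x : ℝ) : 𝕜) = 1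
  rw [hUf x hx, RCLike.ofReal_one]

/-- A distribution vanishes on the test functions supported away from its support. -/
theorem apply_eq_zero_of_disjoint_dsupport (T : 𝓓(Ω, 𝕜) →L_c[𝕜] 𝕜) {f : 𝓓(Ω, 𝕜)}
    (h : Disjoint (tsupport f) (Distribution.dsupport T)) : T f = 0 := by
  obtain ⟨t, g, hg, hs⟩ := f.exists_decomposition
    (fun s : {s : Set E // Distribution.IsVanishingOn T s ∧ IsOpen s} => s.1) (fun s => s.2.2)
    (by
      intro x hx
      obtain ⟨s, hs, hso, hxs⟩ := (Distribution.notMem_dsupport_iff x).1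
        (Set.disjoint_left.1 h hx)
      exact Set.mem_iUnion.2 ⟨⟨s, hs, hso⟩, hxs⟩)
  rw [hg, map_sum]
  exact Finset.sum_eq_zero fun s _ => s.2.1 _ (hs s).1

end Partition

/-! ### The operator on test functions attached to a symbol. -/

section Symbol

open Filter Topology
open scoped ContDiff

variable {𝕜 : Type*} [RCLike 𝕜] {d : ℕ} {Ω : Opens (Fin d → ℝ)}

@[simp]
theorem dilateTestFunction_apply (hΩ : Ω ≤ nonzeroCoords d) (φ : 𝓓(Ω, 𝕜)) (y : Fin d → ℝ)
    (hy : y ∈ nonzeroCoords d) (x : Fin d → ℝ) : dilateTestFunction hΩ φ y hy x = φ (x * y) := rfl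

theorem mul_inv_cancel_of_mem {x : Fin d → ℝ} (hx : x ∈ nonzeroCoords d) : x * x⁻¹ = 1 := by
  ext j
  exact mul_inv_cancel₀ (hx j)

theorem inv_mul_cancel_of_mem {x : Fin d → ℝ} (hx : x ∈ nonzeroCoords d) : x⁻¹ * x = 1 := by
  rw [mul_comm, mul_inv_cancel_of_mem hx]

theorem inv_mem_nonzeroCoords {x : Fin d → ℝ} (hx : x ∈ nonzeroCoords d) :
    x⁻¹ ∈ nonzeroCoords d := fun j => inv_ne_zero (hx j)

theorem mul_mem_nonzeroCoords {x y : Fin d → ℝ} (hx : x ∈ nonzeroCoords d)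
    (hy : y ∈ nonzeroCoords d) : x * y ∈ nonzeroCoords d := fun j => mul_ne_zero (hx j) (hy j)

theorem continuousOn_inv_nonzeroCoords :
    ContinuousOn (fun x : Fin d → ℝ => x⁻¹) (nonzeroCoords d) :=
  continuousOn_pi.2 fun j => (continuous_apply j).continuousOn.inv₀ fun _ hx => hx j

theorem isCompact_image2_mul_inv {K Q : Set (Fin d → ℝ)} (hK : IsCompact K) (hQ : IsCompact Q)
    (hQO : Q ⊆ nonzeroCoords d) : IsCompact (Set.image2 (fun z x => z * x⁻¹) K Q) := by
  rw [← Set.image_uncurry_prod]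
  refine (hK.prod hQ).image_of_continuousOn ?_
  exact continuousOn_fst.mul
    (continuousOn_inv_nonzeroCoords.comp continuousOn_snd fun z hz => hQO hz.2)

theorem apply_eq_zero_of_disjoint_supportIn (T : ScalarDistribution 𝕜 Ω) {f : 𝓓(Ω, 𝕜)}
    (h : Disjoint (tsupport f) (supportIn T)) : T f = 0 :=
  apply_eq_zero_of_disjoint_dsupport T <| Set.disjoint_left.2 fun _ hx hx' =>
    Set.disjoint_left.1 h hx ⟨hx', f.tsupport_subset hx⟩

theorem apply_eq_apply_of_eqOn_nhds (T : ScalarDistribution 𝕜 Ω) {f g : 𝓓(Ω, 𝕜)}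
    {U : Set (Fin d → ℝ)} (hU : IsOpen U) (hTU : supportIn T ⊆ U) (h : ∀ x ∈ U, f x = g x) :
    T f = T g := by
  rw [← sub_eq_zero, ← map_sub]
  refine apply_eq_zero_of_disjoint_supportIn T (Set.disjoint_left.2 fun x hx hx' => ?_)
  have h1 : tsupport (f - g : 𝓓(Ω, 𝕜)) ⊆ Uᶜ := by
    refine closure_minimal (fun x hx hxU => hx ?_) hU.isClosed_compl
    change f x - g x = 0
    rw [h x hxU, sub_self]
  exact h1 hx (hTU hx')

theorem tsupport_mulDilate_subset {O : Opens (Fin d → ℝ)} (χ : 𝓓(O, 𝕜)) (y : Fin d → ℝ)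
    (φ : 𝓓(Ω, 𝕜)) :
    tsupport (mulDilate Ω χ y φ) ⊆ tsupport χ ∩ {x | x * y ∈ tsupport φ} := by
  refine closure_minimal (fun x hx => ?_)
    ((isClosed_tsupport _).inter ((isClosed_tsupport _).preimage (by fun_prop)))
  rw [Function.mem_support, mulDilate_apply] at hx
  exact ⟨subset_tsupport _ (left_ne_zero_of_mul hx), subset_tsupport _ (right_ne_zero_of_mul hx)⟩

/-- The operator on test functions which defines the convolution with a Hadamard symbol. -/
theorem IsHadamardSymbol.exists_operator (hΩ : Ω ≤ nonzeroCoords d)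
    {T : ScalarDistribution 𝕜 (nonzeroCoords d)} (hT : IsHadamardSymbol Ω T) :
    ∃ (χ : 𝓓(nonzeroCoords d, 𝕜)) (M : 𝓓(Ω, 𝕜) →L[𝕜] 𝓓(Ω, 𝕜)),
      (∀ φ y, M φ y = T (mulDilate Ω χ y φ)) ∧
      ∀ φ y (hy : y ∈ nonzeroCoords d), M φ y = T (dilateTestFunction hΩ φ y hy) := by
  obtain ⟨χ, U, hU, hTU, hχ⟩ := TestFunction.exists_eq_one_nhds 𝕜 hT.1
    (Set.inter_subset_right : supportIn T ⊆ nonzeroCoords d)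
  -- The quotient `K / supp T` contains the support of `y ↦ T_x φ(xy)` when `φ` is supported in `K`.
  -- The condition `1 / supp T ⊆ V_*(Ω)` is what keeps it inside `Ω`.
  let κ : Compacts (Fin d → ℝ) → Compacts (Fin d → ℝ) := fun K =>
    ⟨Set.image2 (fun z x => z * x⁻¹) K (supportIn T),
      isCompact_image2_mul_inv K.isCompact hT.1 Set.inter_subset_right⟩
  have hκ : ∀ K : Compacts (Fin d → ℝ), (K : Set (Fin d → ℝ)) ⊆ Ω →
      (κ K : Set (Fin d → ℝ)) ⊆ Ω := by
    rintro K hK _ ⟨z, hz, x, hx, rfl⟩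
    have h1 := (hT.2 ⟨x, hx, rfl⟩).2 z (hK hz)
    rwa [mul_comm] at h1
  have hzero : ∀ (φ : 𝓓(Ω, 𝕜)) (K : Compacts (Fin d → ℝ)), tsupport φ ⊆ K → ∀ y ∉ κ K,
      T (mulDilate Ω χ y φ) = 0 := by
    intro φ K hK y hy
    refine apply_eq_zero_of_disjoint_supportIn T (Set.disjoint_left.2 fun x hx hxT => hy ?_)
    refine ⟨x * y, hK (tsupport_mulDilate_subset _ _ _ hx).2, x, hxT, ?_⟩
    change x * y * x⁻¹ = y
    rw [mul_comm x, mul_assoc, mul_inv_cancel_of_mem hxT.2, mul_one]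
  have hsupp : ∀ (φ : 𝓓(Ω, 𝕜)), Function.support (fun y => T (mulDilate Ω χ y φ)) ⊆
      κ φ.support := fun φ y hy => by
    by_contra h
    exact hy (hzero φ φ.support subset_rfl y h)
  let A : 𝓓(Ω, 𝕜) → 𝓓(Ω, 𝕜) := fun φ =>
    ⟨fun y => T (mulDilate Ω χ y φ), contDiff_mulDilate χ φ T,
      HasCompactSupport.of_support_subset_isCompact (κ φ.support).isCompact (hsupp φ),
      (closure_minimal (hsupp φ) (κ φ.support).isCompact.isClosed).trans
        (hκ _ φ.support_subset)⟩
  have hA : ∀ φ y, A φ y = T (mulDilate Ω χ y φ) := fun _ _ => rfl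
  refine ⟨χ, TestFunction.mkCLMOfBounds A (fun f g => ?_) (fun c f => ?_) (fun K hK => ?_),
    hA, fun φ y hy => ?_⟩
  · ext y
    change A (f + g) y = A f y + A g y
    rw [hA, hA, hA, map_add, map_add]
  · ext y
    change A (c • f) y = c • A f y
    rw [hA, hA, map_smul, map_smul]
  · refine ⟨κ K, hκ K hK, fun f y hy => hzero _ K f.tsupport_subset y hy, fun i => ?_⟩
    obtain ⟨m, C, hC, h⟩ := exists_norm_iteratedFDeriv_mulDilate_le (O₁ := Ω) χ T
      (κ K).isCompact i
    exact ⟨m, C, hC, fun f M hM y hy => h (TestFunction.ofSupportedIn hK f) M hM y hy⟩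
  · rw [TestFunction.mkCLMOfBounds_apply, hA]
    refine apply_eq_apply_of_eqOn_nhds T hU hTU fun x hx => ?_
    rw [mulDilate_apply, hχ x hx, one_mul, dilateTestFunction_apply]

/-- The function `ψ` in the definition is unique: it is prescribed where no coordinate vanishes, and
elsewhere it is zero as a test function on `Ω`. -/
theorem IsMulConv.eq_comp {hΩ : Ω ≤ nonzeroCoords d} {S R : ScalarDistribution 𝕜 Ω}
    {T : ScalarDistribution 𝕜 (nonzeroCoords d)} (h : IsMulConv hΩ S T R)
    {M : 𝓓(Ω, 𝕜) → 𝓓(Ω, 𝕜)}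
    (hM : ∀ φ y (hy : y ∈ nonzeroCoords d), M φ y = T (dilateTestFunction hΩ φ y hy))
    (φ : 𝓓(Ω, 𝕜)) : R φ = S (M φ) := by
  obtain ⟨ψ, hψ, hR⟩ := h φ
  have : ψ = M φ := by
    ext y
    by_cases hy : y ∈ nonzeroCoords d
    · rw [hψ y hy, hM φ y hy]
    · have hy' : y ∉ Ω := fun h => hy (hΩ h)
      rw [ψ.eq_zero_of_notMem hy', (M φ).eq_zero_of_notMem hy']
  rw [hR, this]

end Symbol

/-! ### Monomials are eigenvectors of convolution operators. -/

section Eigenvalues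

open Filter Topology
open scoped ContDiff

variable {𝕜 : Type*} [RCLike 𝕜] {d : ℕ} {Ω : Opens (Fin d → ℝ)}

theorem integral_comp_mul_of_mem {x : Fin d → ℝ} (hx : x ∈ nonzeroCoords d) {F : (Fin d → ℝ) → 𝕜}
    (hF : Continuous F) : ∫ y, F (x * y) = ((|∏ j, x j|⁻¹ : ℝ) : 𝕜) * ∫ z, F z := by
  have hx0 : ∏ j, x j ≠ 0 := Finset.prod_ne_zero_iff.2 fun j _ => hx j
  have h1 := Real.smul_map_diagonal_volume_pi (D := x) (by rwa [Matrix.det_diagonal])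
  have h2 : Measurable (Matrix.toLin' (Matrix.diagonal x)) :=
    (LinearMap.continuous_of_finiteDimensional _).measurable
  have h3 : ∀ y, Matrix.toLin' (Matrix.diagonal x) y = x * y := fun y => by
    ext j
    simp [Matrix.mulVec_diagonal]
  have h4 : ∫ z, F z = |∏ j, x j| • ∫ y, F (x * y) := by
    conv_lhs => rw [← h1, Matrix.det_diagonal]
    rw [integral_smul_measure, integral_map h2.aemeasurable hF.aestronglyMeasurable,
      ENNReal.toReal_ofReal (abs_nonneg _)]
    simp_rw [h3]
  rw [h4, RCLike.real_smul_eq_coe_mul, ← mul_assoc, ← RCLike.ofReal_mul,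
    inv_mul_cancel₀ (abs_ne_zero.2 hx0), RCLike.ofReal_one, one_mul]

/-- The monomial `ξ ^ α`. -/
def monomialFun (α : Fin d → ℕ) (ξ : Fin d → ℝ) : ℝ := ∏ j, ξ j ^ α j

theorem monomialFun_mul (α : Fin d → ℕ) (ξ η : Fin d → ℝ) :
    monomialFun α (ξ * η) = monomialFun α ξ * monomialFun α η := by
  simp [monomialFun, mul_pow, Finset.prod_mul_distrib]

theorem monomialFun_ne_zero (α : Fin d → ℕ) {ξ : Fin d → ℝ} (hξ : ξ ∈ nonzeroCoords d) :
    monomialFun α ξ ≠ 0 := Finset.prod_ne_zero_iff.2 fun j _ => pow_ne_zero _ (hξ j)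

theorem contDiff_monomialFun (α : Fin d → ℕ) : ContDiff ℝ ∞ (monomialFun α) :=
  contDiff_prod fun j _ => (contDiff_apply ℝ ℝ j).pow _

theorem continuous_ofReal_monomialFun (𝕜 : Type*) [RCLike 𝕜] (α : Fin d → ℕ) :
    Continuous fun ξ => (monomialFun α ξ : 𝕜) :=
  RCLike.continuous_ofReal.comp (contDiff_monomialFun α).continuous

theorem monomialDistribution_apply' (α : Fin d → ℕ) (φ : 𝓓(Ω, 𝕜)) :
    monomialDistribution 𝕜 Ω α φ = ∫ ξ, φ ξ * (monomialFun α ξ : 𝕜) :=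
  monomialDistribution_apply 𝕜 Ω α φ

/-- Otherwise the monomial would vanish almost everywhere on `Ω`, a set of positive measure where it
has no zeros. -/
theorem monomialDistribution_ne_zero (hne : (Ω : Set (Fin d → ℝ)).Nonempty)
    (hΩ : Ω ≤ nonzeroCoords d) (α : Fin d → ℕ) : monomialDistribution 𝕜 Ω α ≠ 0 := by
  intro h0
  have h1 := Ω.isOpen.ae_eq_zero_of_integral_contDiff_smul_eq_zero (μ := volume)
    (f := fun ξ => (monomialFun α ξ : 𝕜))
    ((continuous_ofReal_monomialFun 𝕜 α).locallyIntegrable.locallyIntegrableOn _) (by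
      intro g hg hgc hgs
      have hsupp : Function.support (fun x => (g x : 𝕜)) ⊆ tsupport g := fun x hx =>
        subset_tsupport _ fun h => hx (by simp [h])
      let φ : 𝓓(Ω, 𝕜) := ⟨fun x => (g x : 𝕜), contDiff_ofReal_comp hg,
        HasCompactSupport.of_support_subset_isCompact hgc hsupp,
        (closure_minimal hsupp (isClosed_tsupport g)).trans hgs⟩
      have h2 : monomialDistribution 𝕜 Ω α φ = 0 := by
        rw [h0]
        rfl
      rw [monomialDistribution_apply'] at h2
      simp_rw [RCLike.real_smul_eq_coe_mul]
      exact h2)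
  have h2 : volume (Ω : Set (Fin d → ℝ)) = 0 := by
    refine measure_mono_null (fun x hx => ?_) h1
    exact fun h => monomialFun_ne_zero α (hΩ hx) (by simpa using h hx)
  exact (Ω.isOpen.measure_pos volume hne).ne' h2

/-- A Hadamard symbol multiplies the moments of test functions. -/
theorem exists_moment_eq (T : ScalarDistribution 𝕜 (nonzeroCoords d))
    (χ : 𝓓(nonzeroCoords d, 𝕜)) (M : 𝓓(Ω, 𝕜) → 𝓓(Ω, 𝕜))
    (hM : ∀ φ y, M φ y = T (mulDilate Ω χ y φ)) (α : Fin d → ℕ) :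
    ∃ m : 𝕜, ∀ φ, monomialDistribution 𝕜 Ω α (M φ) = m * monomialDistribution 𝕜 Ω α φ := by
  -- The factor produced by the substitution `z = xy`: the Jacobian times `x^{-α}`. It is singular
  -- on the coordinate hyperplanes, so `χ` cuts it off, and `T` of the product is the eigenvalue.
  let a : (Fin d → ℝ) → ℝ := fun x => |∏ j, x j|⁻¹ * (monomialFun α x)⁻¹
  have ha : ∀ x ∈ nonzeroCoords d, ContDiffAt ℝ ∞ a x := by
    intro x hx
    have hx0 : ∏ j, x j ≠ 0 := Finset.prod_ne_zero_iff.2 fun j _ => hx j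
    have h1 : ContDiff ℝ ∞ fun x : Fin d → ℝ => ∏ j, x j :=
      contDiff_prod fun j _ => contDiff_apply ℝ ℝ j
    exact (((contDiffAt_abs hx0).comp x h1.contDiffAt).inv (abs_ne_zero.2 hx0)).mul
      ((contDiff_monomialFun α).contDiffAt.inv (monomialFun_ne_zero α hx))
  let h : 𝓓(nonzeroCoords d, 𝕜) :=
    { toFun := fun x => (a x : 𝕜) * χ x
      contDiff' := by
        refine contDiff_iff_contDiffAt.2 fun x => ?_
        by_cases hx : x ∈ tsupport χ
        · exact ((RCLike.ofRealCLM (K := 𝕜)).contDiff.contDiffAt.comp x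
            (ha x (χ.tsupport_subset hx))).mul χ.contDiff.contDiffAt
        · refine (contDiffAt_const (c := 0)).congr_of_eventuallyEq ?_
          filter_upwards [notMem_tsupport_iff_eventuallyEq.1 hx] with z hz
          rw [hz, Pi.zero_apply, mul_zero]
      hasCompactSupport' := χ.hasCompactSupport.mul_left
      tsupport_subset' := tsupport_mul_subset_right.trans χ.tsupport_subset }
  refine ⟨T h, fun φ => ?_⟩
  -- Large enough that both the integral of `y^α φ(xy)`, for every `x` in the support of `χ`, and
  -- the moment of `M φ` reduce to integrals over it.
  let κ : Set (Fin d → ℝ) :=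
    Set.image2 (fun z x => z * x⁻¹) (tsupport φ) (tsupport χ) ∪ tsupport (M φ)
  have hκ : IsCompact κ := (isCompact_image2_mul_inv φ.hasCompactSupport χ.hasCompactSupport
    χ.tsupport_subset).union (M φ).hasCompactSupport
  have hγ : Continuous fun y => monomialFun α y • mulDilate Ω χ y φ :=
    (contDiff_monomialFun α).continuous.smul (continuous_mulDilate χ φ)
  have key := apply_eq_setIntegral_of_forall volume hκ hγ.continuousOn
    (g := monomialDistribution 𝕜 Ω α φ • h) (by
      intro x
      change monomialDistribution 𝕜 Ω α φ • ((a x : 𝕜) * χ x) =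
        ∫ y in κ, monomialFun α y • (χ x * φ (x * y))
      by_cases hx : x ∈ tsupport χ
      swap
      · simp [image_eq_zero_of_notMem_tsupport hx]
      have hxO := χ.tsupport_subset hx
      rw [setIntegral_eq_integral_of_forall_compl_eq_zero (by
        intro y hy
        have : x * y ∉ tsupport φ := fun h => hy <| Or.inl ⟨x * y, h, x, hx, by
          change x * y * x⁻¹ = y
          rw [mul_comm x, mul_assoc, mul_inv_cancel_of_mem hxO, mul_one]⟩
        rw [image_eq_zero_of_notMem_tsupport this, mul_zero, smul_zero])]
      have h1 : ∀ y, monomialFun α y • (χ x * φ (x * y)) =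
          (χ x * ((monomialFun α x)⁻¹ : ℝ)) * (φ (x * y) * (monomialFun α (x * y) : 𝕜)) := by
        intro y
        have h2 : (monomialFun α x : 𝕜) ≠ 0 :=
          RCLike.ofReal_ne_zero.2 (monomialFun_ne_zero α hxO)
        rw [monomialFun_mul, RCLike.real_smul_eq_coe_mul, RCLike.ofReal_mul, RCLike.ofReal_inv]
        field_simp
      simp_rw [h1]
      rw [integral_const_mul, integral_comp_mul_of_mem hxO
        (F := fun z => φ z * (monomialFun α z : 𝕜))
        (φ.continuous.mul (continuous_ofReal_monomialFun 𝕜 α)), ← monomialDistribution_apply']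
      simp only [a, smul_eq_mul, RCLike.ofReal_mul]
      ring) T
  rw [map_smul, smul_eq_mul, mul_comm] at key
  rw [key, monomialDistribution_apply', ← setIntegral_eq_integral_of_forall_compl_eq_zero (s := κ)
    (fun y hy => by
      rw [image_eq_zero_of_notMem_tsupport fun h => hy (Or.inr h), zero_mul])]
  refine integral_congr_ae (Eventually.of_forall fun y => ?_)
  have h2 : monomialFun α y • mulDilate Ω χ y φ = (monomialFun α y : 𝕜) • mulDilate Ω χ y φ := by
    ext x
    exact RCLike.real_smul_eq_coe_mul _ _
  change M φ y * _ = T (monomialFun α y • mulDilate Ω χ y φ)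
  rw [h2, map_smul, hM, smul_eq_mul, mul_comm]

/-- The operators of convolution with a Hadamard symbol are Hadamard operators. -/
theorem isHadamardOperator_of_symbol (hne : (Ω : Set (Fin d → ℝ)).Nonempty)
    (hΩ : Ω ≤ nonzeroCoords d) {T : ScalarDistribution 𝕜 (nonzeroCoords d)}
    (hT : IsHadamardSymbol Ω T) {L : ScalarDistribution 𝕜 Ω → ScalarDistribution 𝕜 Ω}
    (hL : ∀ S, IsMulConv hΩ S T (L S)) : IsHadamardOperator L := by
  obtain ⟨χ, M, hMχ, hM⟩ := hT.exists_operator hΩ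
  let A : ScalarDistribution 𝕜 Ω →L[𝕜] ScalarDistribution 𝕜 Ω := M.precompCompactConvergenceCLM 𝕜
  have hA : ∀ S φ, A S φ = S (M φ) := fun _ _ => rfl
  refine ⟨A, ?_, fun α => ?_⟩
  · ext S φ
    rw [hA, (hL S).eq_comp hM]
  · obtain ⟨m, hm⟩ := exists_moment_eq T χ M hMχ α
    refine ⟨m, Module.End.hasEigenvector_iff.2 ⟨Module.End.mem_eigenspace_iff.2 ?_,
      monomialDistribution_ne_zero hne hΩ α⟩⟩
    ext φ
    exact hm φ

theorem IsHadamardSymbol.exists_isMulConv (hΩ : Ω ≤ nonzeroCoords d)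
    {T : ScalarDistribution 𝕜 (nonzeroCoords d)} (hT : IsHadamardSymbol Ω T)
    (S : ScalarDistribution 𝕜 Ω) : ∃ R : ScalarDistribution 𝕜 Ω, IsMulConv hΩ S T R := by
  obtain ⟨-, M, -, hM⟩ := hT.exists_operator hΩ
  exact ⟨M.precompCompactConvergenceCLM 𝕜 S, fun φ => ⟨M φ, hM φ, rfl⟩⟩

end Eigenvalues

/-! ### Determination of functions by their moments. -/

section Moments

open Filter Topology

variable {𝕜 : Type*} [RCLike 𝕜] {d : ℕ}

/-- Weierstrass approximation by polynomials in several variables. -/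
theorem exists_mvPolynomial_near {Q : Set (Fin d → ℝ)} (hQ : IsCompact Q) {g : (Fin d → ℝ) → ℝ}
    (hg : Continuous g) {ε : ℝ} (hε : 0 < ε) :
    ∃ p : MvPolynomial (Fin d) ℝ, ∀ ξ ∈ Q,
      |∑ a ∈ p.support, p.coeff a * monomialFun a ξ - g ξ| < ε := by
  have : CompactSpace Q := isCompact_iff_compactSpace.1 hQ
  let c : Fin d → C(Q, ℝ) := fun j => ⟨fun ξ => ξ.1 j,
    (continuous_apply j).comp continuous_subtype_val⟩
  let Φ : MvPolynomial (Fin d) ℝ →ₐ[ℝ] C(Q, ℝ) := MvPolynomial.aeval c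
  have hΦ : ∀ p (ξ : Q), Φ p ξ = ∑ a ∈ p.support, p.coeff a * monomialFun a ξ.1 := by
    intro p ξ
    simp only [Φ, MvPolynomial.aeval_def, MvPolynomial.eval₂_eq', ContinuousMap.coe_sum,
      Finset.sum_apply]
    refine Finset.sum_congr rfl fun a _ => ?_
    simp [c, monomialFun, ContinuousMap.coe_prod, Algebra.algebraMap_eq_smul_one]
  obtain ⟨⟨f, p, rfl⟩, hf⟩ :=
    ContinuousMap.exists_mem_subalgebra_near_continuous_of_separatesPoints Φ.range (by
      intro x y hxy
      obtain ⟨j, hj⟩ := Function.ne_iff.1 (fun h => hxy (Subtype.ext h) : x.1 ≠ y.1)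
      exact ⟨c j, ⟨c j, ⟨MvPolynomial.X j, by simp [Φ]⟩, rfl⟩, hj⟩)
    (fun ξ : Q => g ξ) (hg.comp continuous_subtype_val) ε hε
  refine ⟨p, fun ξ hξ => ?_⟩
  have h1 := hf ⟨ξ, hξ⟩
  rw [Real.norm_eq_abs] at h1
  have h2 := hΦ p ⟨ξ, hξ⟩
  rw [← h2]
  exact h1

/-- Polynomials are orthogonal to `g`, so approximating `g` within `ε` on its support gives `∫ g² ≤
ε ∫ |g|` for every `ε > 0`. -/
theorem eq_zero_of_moments_eq_zero {g : (Fin d → ℝ) → ℝ} (hg : Continuous g)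
    (hgc : HasCompactSupport g) (h : ∀ α : Fin d → ℕ, ∫ ξ, g ξ * monomialFun α ξ = 0) : g = 0 := by
  have hgi : ∀ f : (Fin d → ℝ) → ℝ, Continuous f → Integrable fun ξ => g ξ * f ξ := fun f hf =>
    (hg.mul hf).integrable_of_hasCompactSupport hgc.mul_right
  have hle : ∀ ε > 0, ∫ ξ, g ξ * g ξ ≤ ε * ∫ ξ, |g ξ| := by
    intro ε hε
    obtain ⟨p, hp⟩ := exists_mvPolynomial_near hgc.isCompact hg hε
    let P : (Fin d → ℝ) → ℝ := fun ξ => ∑ a ∈ p.support, p.coeff a * monomialFun a ξ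
    have hPc : Continuous P := continuous_finsetSum _ fun a _ =>
      continuous_const.mul (contDiff_monomialFun a).continuous
    have h0 : ∫ ξ, g ξ * P ξ = 0 := by
      simp only [P, Finset.mul_sum]
      have hi : ∀ a ∈ p.support, Integrable fun ξ => g ξ * (p.coeff a * monomialFun a ξ) :=
        fun a _ => hgi _ (continuous_const.mul (contDiff_monomialFun a).continuous)
      rw [integral_finsetSum _ hi]
      refine Finset.sum_eq_zero fun a _ => ?_
      simp_rw [mul_left_comm (g _)]
      rw [integral_const_mul, h, mul_zero]
    rw [← sub_zero (∫ ξ, g ξ * g ξ), ← h0, ← integral_sub (hgi g hg) (hgi P hPc),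
      ← integral_const_mul]
    refine integral_mono ((hgi g hg).sub (hgi P hPc))
      ((hg.abs.integrable_of_hasCompactSupport hgc.abs).const_mul ε) fun ξ => ?_
    change g ξ * g ξ - g ξ * P ξ ≤ ε * |g ξ|
    by_cases hξ : ξ ∈ tsupport g
    · rw [← mul_sub]
      refine (le_abs_self _).trans ?_
      rw [abs_mul, mul_comm]
      refine mul_le_mul_of_nonneg_right ?_ (abs_nonneg _)
      rw [abs_sub_comm]
      exact (hp ξ hξ).le
    · simp [image_eq_zero_of_notMem_tsupport hξ]
  by_contra hne
  have hpos := (hg.mul hg).integral_pos_of_hasCompactSupport_nonneg_nonzero (μ := volume)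
    hgc.mul_right (fun ξ => mul_self_nonneg (g ξ)) (x := (Function.ne_iff.1 hne).choose)
    (mul_self_ne_zero.2 (Function.ne_iff.1 hne).choose_spec)
  have hI : 0 ≤ ∫ ξ, |g ξ| := integral_nonneg fun _ => abs_nonneg _
  change 0 < ∫ ξ, g ξ * g ξ at hpos
  have h1 := hle ((∫ ξ, g ξ * g ξ) / (2 * (1 + ∫ ξ, |g ξ|))) (by positivity)
  rw [div_mul_eq_mul_div, le_div_iff₀ (by positivity)] at h1
  nlinarith

/-- Continuous functions with compact support are determined by their moments. -/
theorem eq_of_moments_eq {f g : (Fin d → ℝ) → 𝕜} (hf : Continuous f) (hfc : HasCompactSupport f)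
    (hg : Continuous g) (hgc : HasCompactSupport g)
    (h : ∀ α : Fin d → ℕ,
      ∫ ξ, f ξ * (monomialFun α ξ : 𝕜) = ∫ ξ, g ξ * (monomialFun α ξ : 𝕜)) : f = g := by
  have hInt : ∀ {u : (Fin d → ℝ) → 𝕜}, Continuous u → HasCompactSupport u → ∀ α : Fin d → ℕ,
      Integrable fun ξ => u ξ * (monomialFun α ξ : 𝕜) := fun hu huc α =>
    (hu.mul (continuous_ofReal_monomialFun 𝕜 α)).integrable_of_hasCompactSupport huc.mul_right
  have hc : Continuous fun ξ => f ξ - g ξ := hf.sub hg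
  have hs : HasCompactSupport fun ξ => f ξ - g ξ := hfc.sub hgc
  have h0 : ∀ α : Fin d → ℕ, ∫ ξ, (f ξ - g ξ) * (monomialFun α ξ : 𝕜) = 0 := by
    intro α
    simp_rw [sub_mul]
    rw [integral_sub (hInt hf hfc α) (hInt hg hgc α), h, sub_self]
  have hre := eq_zero_of_moments_eq_zero (g := fun ξ => RCLike.re (f ξ - g ξ))
    (RCLike.continuous_re.comp hc) (hs.comp_left (map_zero RCLike.re)) (fun α => by
      have h1 := integral_re (hInt hc hs α)
      rw [h0, map_zero] at h1
      simpa using h1)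
  have him := eq_zero_of_moments_eq_zero (g := fun ξ => RCLike.im (f ξ - g ξ))
    (RCLike.continuous_im.comp hc) (hs.comp_left (map_zero RCLike.im)) (fun α => by
      have h1 := integral_im (hInt hc hs α)
      rw [h0, map_zero] at h1
      simpa using h1)
  ext ξ
  rw [← sub_eq_zero]
  exact RCLike.ext (by simpa using congrFun hre ξ) (by simpa using congrFun him ξ)

end Moments

/-! ### Transposes of continuous operators on distributions. -/

section Transpose

open Filter Topology

variable {𝕜 E : Type*} [RCLike 𝕜] [NormedAddCommGroup E] [NormedSpace ℝ E] {Ω : Opens E}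

theorem exists_compact_bound_operator
    (A : (𝓓(Ω, 𝕜) →L_c[𝕜] 𝕜) →L[𝕜] (𝓓(Ω, 𝕜) →L_c[𝕜] 𝕜)) {C : Set 𝓓(Ω, 𝕜)} (hC : IsCompact C) :
    ∃ C' : Set 𝓓(Ω, 𝕜), IsCompact C' ∧ ∃ ε > 0, ∀ S : 𝓓(Ω, 𝕜) →L_c[𝕜] 𝕜,
      (∀ φ ∈ C', ‖S φ‖ < ε) → ∀ φ ∈ C, ‖A S φ‖ < 1 := by
  have hb := CompactConvergenceCLM.hasBasis_nhds_zero_of_basis (σ := RingHom.id 𝕜)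
      (E := 𝓓(Ω, 𝕜)) (F := 𝕜) Metric.nhds_basis_ball
  have hA : Tendsto A (𝓝 0) (𝓝 0) := by
    have := A.continuous.tendsto 0
    rwa [map_zero] at this
  obtain ⟨⟨C', ε⟩, ⟨hC', hε⟩, hsub⟩ := (hb.tendsto_iff hb).1 hA (C, 1) ⟨hC, one_pos⟩
  refine ⟨C', hC', ε, hε, fun S hS φ hφ => ?_⟩
  exact mem_ball_zero_iff.1 (hsub S (fun ψ hψ => mem_ball_zero_iff.2 (hS ψ hψ)) φ hφ)

variable [FiniteDimensional ℝ E]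

/-- A continuous operator on distributions is the transpose of a map of test functions. -/
theorem exists_transpose (A : (𝓓(Ω, 𝕜) →L_c[𝕜] 𝕜) →L[𝕜] (𝓓(Ω, 𝕜) →L_c[𝕜] 𝕜)) :
    ∃ M : 𝓓(Ω, 𝕜) → 𝓓(Ω, 𝕜), ∀ S φ, A S φ = S (M φ) := by
  have h : ∀ φ : 𝓓(Ω, 𝕜), ∃ ψ : 𝓓(Ω, 𝕜), ∀ S, A S φ = S ψ := by
    intro φ
    let Λ : (𝓓(Ω, 𝕜) →L_c[𝕜] 𝕜) →ₗ[𝕜] 𝕜 :=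
      { toFun := fun S => S φ
        map_add' := fun _ _ => rfl
        map_smul' := fun _ _ => rfl }
    have hΛ : Continuous Λ := continuous_of_compact_bound Λ (isCompact_singleton (x := φ)) 1
      fun S u _ hS => (hS φ rfl).trans_eq (one_mul u).symm
    exact exists_testFunction_of_continuous ((⟨Λ, hΛ⟩ : (𝓓(Ω, 𝕜) →L_c[𝕜] 𝕜) →L[𝕜] 𝕜).comp A)
  exact ⟨fun φ => (h φ).choose, fun S φ => (h φ).choose_spec S⟩

/-- Any sequence of test functions with a common support can be scaled into a compact set. -/
theorem exists_scaling_mem_compact {K : Compacts E} (hK : (K : Set E) ⊆ Ω)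
    (f : ℕ → 𝓓_{K}(E, 𝕜)) :
    ∃ (C : Set 𝓓(Ω, 𝕜)) (c : ℕ → ℝ), IsCompact C ∧ (∀ n, 0 < c n) ∧
      ∀ n, (c n : 𝕜) • TestFunction.ofSupportedIn hK (f n) ∈ C := by
  let N : ℕ → ℕ → ℝ := fun i n => ContDiffMapSupportedIn.seminorm 𝕜 E 𝕜 ⊤ K i (f n)
  have hN : ∀ i n, 0 ≤ N i n := fun i n => apply_nonneg _ _
  -- This brings the seminorms of `f n` of order at most `n` below `1`. For fixed `i` only the
  -- indices `n < i` escape, and their finitely many values are added into `B i`.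
  let c : ℕ → ℝ := fun n => (1 + ∑ i ∈ Finset.range (n + 1), N i n)⁻¹
  have hc : ∀ n, 0 < c n := fun n =>
    inv_pos.2 (add_pos_of_pos_of_nonneg one_pos (Finset.sum_nonneg fun i _ => hN i n))
  let B : ℕ → ℝ := fun i => 1 + ∑ n ∈ Finset.range i, c n * N i n
  refine ⟨TestFunction.ofSupportedInCLM 𝕜 hK '' derivBoundedSet 𝕜 K B, c,
    (isCompact_derivBoundedSet K B).image (ContinuousLinearMap.continuous _), hc,
    fun n => ⟨(c n : 𝕜) • f n, fun i x => ?_, rfl⟩⟩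
  have h1 : ‖iteratedFDeriv ℝ i ((c n : 𝕜) • f n : 𝓓_{K}(E, 𝕜)) x‖ ≤ c n * N i n := by
    refine (ContDiffMapSupportedIn.norm_iteratedFDeriv_apply_le_seminorm_top 𝕜).trans ?_
    rw [map_smul_eq_mul, RCLike.norm_ofReal, abs_of_pos (hc n)]
  have hs : ∀ k ∈ Finset.range i, 0 ≤ c k * N i k := fun k _ => mul_nonneg (hc k).le (hN i k)
  refine h1.trans ?_
  rcases lt_or_ge n i with h | h
  · have := Finset.single_le_sum hs (Finset.mem_range.2 h)
    change _ ≤ 1 + _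
    linarith
  · have h2 : c n * N i n ≤ 1 := by
      rw [inv_mul_le_iff₀ (inv_pos.1 (hc n)), mul_one]
      have := Finset.single_le_sum (fun k _ => hN k n)
        (Finset.mem_range.2 (Nat.lt_succ_of_le h))
      linarith
    have := Finset.sum_nonneg hs
    change _ ≤ 1 + _
    linarith

/-- The transpose of a continuous operator on distributions maps the test functions supported in a
compact set to test functions supported in a compact set. -/
theorem exists_support_bound (A : (𝓓(Ω, 𝕜) →L_c[𝕜] 𝕜) →L[𝕜] (𝓓(Ω, 𝕜) →L_c[𝕜] 𝕜))
    {K : Compacts E} (hK : (K : Set E) ⊆ Ω) :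
    ∃ K' : Set E, IsCompact K' ∧ K' ⊆ Ω ∧ ∀ φ : 𝓓(Ω, 𝕜), tsupport φ ⊆ K →
      ∀ y ∉ K', A (diracDistribution 𝕜 Ω y) φ = 0 := by
  obtain ⟨κ, hκc, hκΩ, hκm, hκe⟩ := exists_compact_exhaustion Ω
  by_contra! hcon
  choose φ hφK y hyκ hne using fun n => hcon (κ n) (hκc n) (hκΩ n)
  let f : ℕ → 𝓓_{K}(E, 𝕜) := fun n => ContDiffMapSupportedIn.of_support_subset (φ n).contDiff
    ((subset_tsupport _).trans (hφK n))
  have hf : ∀ n, TestFunction.ofSupportedIn hK (f n) = φ n := fun n => by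
    ext x
    rfl
  obtain ⟨C, c, hC, hc, hcC⟩ := exists_scaling_mem_compact hK f
  obtain ⟨C', hC', ε, hε, hbd⟩ := exists_compact_bound_operator A hC
  obtain ⟨K'', hK''Ω, hK''⟩ := exists_common_support hC'
  obtain ⟨n, hn⟩ := hκe K'' K''.isCompact hK''Ω
  -- As `y n` lies outside the common support of `C'`, every multiple of the evaluation there
  -- vanishes on `C'`, so its image under `A` has norm below `1` on `C`. This multiple is chosen so
  -- that the image takes the value `1` at the scaled `φ n`.
  let a : 𝕜 := ((c n : 𝕜) * A (diracDistribution 𝕜 Ω (y n)) (φ n))⁻¹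
  have h1 := hbd (a • diracDistribution 𝕜 Ω (y n)) (by
    intro ψ hψ
    have h2 : ψ (y n) = 0 := hK'' ψ hψ fun h => hyκ n (hn h)
    have h3 : (a • diracDistribution 𝕜 Ω (y n)) ψ = a • ψ (y n) := rfl
    rw [h3, h2, smul_zero, norm_zero]
    exact hε) _ (hcC n)
  rw [hf, map_smul, map_smul] at h1
  have h4 : (a • A (diracDistribution 𝕜 Ω (y n))) (φ n) =
    a • A (diracDistribution 𝕜 Ω (y n)) (φ n) := rfl
  rw [h4, smul_eq_mul, smul_eq_mul, mul_left_comm,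
    inv_mul_cancel₀ (mul_ne_zero (RCLike.ofReal_ne_zero.2 (hc n).ne') (hne n)), norm_one] at h1
  exact lt_irrefl _ h1

end Transpose

/-! ### Commutation with dilations. -/

section HadamardTranspose

variable {𝕜 : Type*} [RCLike 𝕜] {d : ℕ} {Ω : Opens (Fin d → ℝ)}

/-- The transpose of a Hadamard operator commutes with dilations. -/
theorem transpose_dilate {A : ScalarDistribution 𝕜 Ω →L[𝕜] ScalarDistribution 𝕜 Ω}
    (hA : ∀ α : Fin d → ℕ, ∃ m : 𝕜,
      Module.End.HasEigenvector (A : ScalarDistribution 𝕜 Ω →ₗ[𝕜] ScalarDistribution 𝕜 Ω) m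
        (monomialDistribution 𝕜 Ω α))
    {φ φ' : 𝓓(Ω, 𝕜)} {η : Fin d → ℝ} (hη : η ∈ nonzeroCoords d) (h : ∀ z, φ' z = φ (η * z))
    (y : Fin d → ℝ) :
    A (diracDistribution 𝕜 Ω y) φ' = A (diracDistribution 𝕜 Ω (η * y)) φ := by
  obtain ⟨M, hM⟩ := exists_transpose A
  rw [hM, hM]
  change M φ' y = M φ (η * y)
  have hcomp : ∀ (u : 𝓓(Ω, 𝕜)) (α : Fin d → ℕ),
      ∫ z, u (η * z) * (monomialFun α z : 𝕜) =
        (((monomialFun α η)⁻¹ * |∏ j, η j|⁻¹ : ℝ) : 𝕜) * monomialDistribution 𝕜 Ω α u := by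
    intro u α
    have h1 : ∀ z, u (η * z) * (monomialFun α z : 𝕜) =
        (((monomialFun α η)⁻¹ : ℝ) : 𝕜) * (u (η * z) * (monomialFun α (η * z) : 𝕜)) := by
      intro z
      have h2 : (monomialFun α η : 𝕜) ≠ 0 := RCLike.ofReal_ne_zero.2 (monomialFun_ne_zero α hη)
      rw [monomialFun_mul, RCLike.ofReal_mul, RCLike.ofReal_inv]
      field_simp
    simp_rw [h1]
    rw [integral_const_mul, integral_comp_mul_of_mem hη
      (F := fun z => u z * (monomialFun α z : 𝕜))
      (u.continuous.mul (continuous_ofReal_monomialFun 𝕜 α)), ← monomialDistribution_apply',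
      RCLike.ofReal_mul, mul_assoc]
  -- The dilated function may leave `Ω`, so it is compared with `M φ'` through moments over the
  -- whole space, where continuity and compact support suffice.
  have hcont : Continuous fun y => M φ (η * y) := (M φ).continuous.comp (by fun_prop)
  have hcs : HasCompactSupport fun y => M φ (η * y) :=
    (M φ).hasCompactSupport.comp_homeomorph
      (Homeomorph.piCongrRight fun j => Homeomorph.mulLeft₀ (η j) (hη j))
  refine congrFun (eq_of_moments_eq (M φ').continuous (M φ').hasCompactSupport hcont hcs
    fun α => ?_) y
  obtain ⟨m, hm⟩ := hA α
  have hm' : ∀ u, monomialDistribution 𝕜 Ω α (M u) = m * monomialDistribution 𝕜 Ω α u := by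
    intro u
    have h2 : A (monomialDistribution 𝕜 Ω α) = m • monomialDistribution 𝕜 Ω α := hm.apply_eq_smul
    rw [← hM, h2]
    rfl
  have h3 : monomialDistribution 𝕜 Ω α φ' =
      (((monomialFun α η)⁻¹ * |∏ j, η j|⁻¹ : ℝ) : 𝕜) * monomialDistribution 𝕜 Ω α φ := by
    rw [← hcomp, monomialDistribution_apply']
    simp_rw [h]
  rw [← monomialDistribution_apply', hm', h3, hcomp, hm', mul_left_comm]

end HadamardTranspose

/-! ### Dilated test functions. -/

section Dilations

variable {𝕜 : Type*} [RCLike 𝕜] {d : ℕ} {O₁ O₂ : Opens (Fin d → ℝ)}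

/-- The test function `x ↦ φ (x * η)`. -/
def TestFunction.dilate (φ : 𝓓(O₁, 𝕜)) (η : Fin d → ℝ) (hη : η ∈ nonzeroCoords d)
    (h : ∀ x, x * η ∈ tsupport φ → x ∈ O₂) : 𝓓(O₂, 𝕜) :=
  let e : (Fin d → ℝ) ≃ₜ (Fin d → ℝ) :=
    Homeomorph.piCongrRight fun j => Homeomorph.mulRight₀ (η j) (hη j)
  { toFun := fun x => φ (x * η)
    contDiff' := φ.contDiff.comp (contDiff_id.mul contDiff_const)
    hasCompactSupport' := φ.hasCompactSupport.comp_homeomorph e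
    tsupport_subset' := by
      have hts : tsupport (fun x => φ (x * η)) = e ⁻¹' tsupport φ :=
        tsupport_comp_eq_preimage (φ : (Fin d → ℝ) → 𝕜) e
      rw [hts]
      exact fun x hx => h x hx }

theorem TestFunction.tsupport_dilate_subset (φ : 𝓓(O₁, 𝕜)) (η : Fin d → ℝ)
    (hη : η ∈ nonzeroCoords d) (h : ∀ x, x * η ∈ tsupport φ → x ∈ O₂) :
    tsupport (φ.dilate η hη h) ⊆ {x | x * η ∈ tsupport φ} :=
  closure_minimal (fun x hx => subset_tsupport φ (a := x * η) hx)
    ((isClosed_tsupport _).preimage (by fun_prop))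

theorem mul_inv_mul_cancel_of_mem {x y : Fin d → ℝ} (hy : y ∈ nonzeroCoords d) : x * y⁻¹ * y = x := by
  rw [mul_assoc, inv_mul_cancel_of_mem hy, mul_one]

theorem mul_mul_inv_cancel_of_mem {x y : Fin d → ℝ} (hy : y ∈ nonzeroCoords d) : x * y * y⁻¹ = x := by
  rw [mul_assoc, mul_inv_cancel_of_mem hy, mul_one]

end Dilations

/-! ### Construction of the symbol of a Hadamard operator. -/

section Construction

variable {𝕜 : Type*} [RCLike 𝕜] {d : ℕ} {Ω : Opens (Fin d → ℝ)}

/-- A family of functionals on test functions which behaves like `φ ↦ M φ y` for an operator `M`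
commuting with dilations and mapping the test functions supported in a neighbourhood of some point
to test functions supported in a fixed compact set is given by a distribution. -/
theorem exists_symbol_of_dilate (hΩ : Ω ≤ nonzeroCoords d)
    (N : (Fin d → ℝ) → ScalarDistribution 𝕜 Ω) (hN0 : ∀ y ∉ Ω, N y = 0)
    (hN : ∀ (φ φ' : 𝓓(Ω, 𝕜)) (η : Fin d → ℝ), η ∈ nonzeroCoords d → (∀ z, φ' z = φ (z * η)) →
      ∀ y, N y φ' = N (y * η) φ)
    {y₀ : Fin d → ℝ} {r : ℝ} (hr : 0 < r) (hy₀ : Metric.closedBall y₀ r ⊆ Ω)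
    {K' : Set (Fin d → ℝ)} (hK' : IsCompact K') (hK'Ω : K' ⊆ Ω)
    (hK : ∀ φ : 𝓓(Ω, 𝕜), tsupport φ ⊆ Metric.closedBall y₀ r → ∀ y ∉ K', N y φ = 0) :
    ∃ T : ScalarDistribution 𝕜 (nonzeroCoords d), IsHadamardSymbol Ω T ∧
      ∀ (φ : 𝓓(Ω, 𝕜)) y (hy : y ∈ nonzeroCoords d),
        T (dilateTestFunction hΩ φ y hy) = N y φ := by
  classical
  have hy₀Ω : y₀ ∈ Ω := hy₀ (Metric.mem_closedBall_self hr.le)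
  have hy₀O := hΩ hy₀Ω
  have hK'O : K' ⊆ nonzeroCoords d := fun z hz => hΩ (hK'Ω hz)
  -- The points `x` that some `k ∈ Ω` carries to the centre `y₀`. Formally `N k φ = T_x φ(xk)`, so
  -- this is where `T` can be read off from functions supported near `y₀`.
  let W : Opens (Fin d → ℝ) := ⟨{x | x ∈ nonzeroCoords d ∧ y₀ * x⁻¹ ∈ Ω}, by
    have h1 : ContinuousOn (fun x : Fin d → ℝ => y₀ * x⁻¹) (nonzeroCoords d) :=
      continuousOn_const.mul continuousOn_inv_nonzeroCoords
    exact h1.isOpen_inter_preimage (nonzeroCoords d).isOpen Ω.isOpen⟩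
  -- The expected location of `supp T`: for `φ` concentrated near `y₀`, `T_x φ(xy)` sees `T` near
  -- `y₀ / y`, and it vanishes unless `y ∈ K'`.
  let Q : Set (Fin d → ℝ) := Set.image2 (fun z x => z * x⁻¹) {y₀} K'
  have hQ : IsCompact Q := isCompact_image2_mul_inv isCompact_singleton hK' hK'O
  have hQW : Q ⊆ W := by
    rintro _ ⟨_, rfl, x, hx, rfl⟩
    refine ⟨mul_mem_nonzeroCoords hy₀O (inv_mem_nonzeroCoords (hK'O hx)), ?_⟩
    rw [mul_inv, inv_inv, ← mul_assoc, mul_inv_cancel_of_mem hy₀O, one_mul]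
    exact hK'Ω hx
  obtain ⟨χ, V, hV, hQV, hχ⟩ := TestFunction.exists_eq_one_nhds 𝕜 hQ hQW
  obtain ⟨t, χ', hχ', hχ's⟩ := χ.exists_decomposition
    (fun k : {k // k ∈ Ω} => {x | x * k.1 ∈ Metric.ball y₀ r})
    (fun k => Metric.isOpen_ball.preimage (by fun_prop))
    (fun x hx => Set.mem_iUnion.2 ⟨⟨y₀ * x⁻¹, (χ.tsupport_subset hx).2⟩, by
      change x * (y₀ * x⁻¹) ∈ Metric.ball y₀ r
      rw [mul_comm, mul_inv_mul_cancel_of_mem (χ.tsupport_subset hx).1]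
      exact Metric.mem_ball_self hr⟩)
  have hWO : ∀ k, tsupport (χ' k) ⊆ nonzeroCoords d := fun k x hx =>
    ((χ' k).tsupport_subset hx).1
  have hk : ∀ k : {k // k ∈ Ω}, k.1⁻¹ ∈ nonzeroCoords d := fun k =>
    inv_mem_nonzeroCoords (hΩ k.2)
  let χ'' : {k // k ∈ Ω} → 𝓓(Ω, 𝕜) := fun k => (χ' k).dilate k.1⁻¹ (hk k) (fun x hx => by
    have h1 := (hχ's k).1 hx
    rw [Set.mem_ofPred_eq, mul_inv_mul_cancel_of_mem (hΩ k.2)] at h1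
    exact hy₀ (Metric.ball_subset_closedBall h1))
  -- Each summand is formally `T (χ' k * f)`, written as `N k` of that function dilated by `k⁻¹`,
  -- whose support lies in the ball around `y₀`.
  let T₀ : 𝓓(nonzeroCoords d, 𝕜) →L[𝕜] 𝕜 :=
    ∑ k ∈ t, (show 𝓓(Ω, 𝕜) →L[𝕜] 𝕜 from N k.1).comp (mulDilate (nonzeroCoords d) (χ'' k) k.1⁻¹)
  let T : ScalarDistribution 𝕜 (nonzeroCoords d) := T₀
  have hT : ∀ f, T f = ∑ k ∈ t, N k.1 (mulDilate (nonzeroCoords d) (χ'' k) k.1⁻¹ f) := fun f => by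
    change T₀ f = _
    rw [sum_apply]
    rfl
  -- A piece of `w` near `z` is dilated into the ball around `y₀`. This moves `y` to `y z⁻¹ y₀`,
  -- which lies outside `K'` because `z y⁻¹ ∉ Q`.
  have hcut : ∀ (w : 𝓓(Ω, 𝕜)) (y : Fin d → ℝ), y ∈ nonzeroCoords d →
      (∀ z ∈ tsupport w, z * y⁻¹ ∉ Q) → N y w = 0 := by
    intro w y hy hw
    obtain ⟨s, g, hg, hgs⟩ := w.exists_decomposition
      (fun z : {z // z ∈ tsupport w} => {x | x * (z.1⁻¹ * y₀) ∈ Metric.ball y₀ r})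
      (fun z => Metric.isOpen_ball.preimage (by fun_prop))
      (fun z hz => Set.mem_iUnion.2 ⟨⟨z, hz⟩, by
        rw [Set.mem_ofPred_eq, ← mul_assoc,
          mul_inv_cancel_of_mem (hΩ (w.tsupport_subset hz)), one_mul]
        exact Metric.mem_ball_self hr⟩)
    rw [hg, map_sum]
    refine Finset.sum_eq_zero fun z _ => ?_
    have hzO := hΩ (w.tsupport_subset z.2)
    have hη : z.1 * y₀⁻¹ ∈ nonzeroCoords d :=
      mul_mem_nonzeroCoords hzO (inv_mem_nonzeroCoords hy₀O)
    have hball : ∀ x, x * (z.1 * y₀⁻¹) ∈ tsupport (g z) → x ∈ Metric.closedBall y₀ r := by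
      intro x hx
      have h1 := (hgs z).1 hx
      have h2 : x * (z.1 * y₀⁻¹) * (z.1⁻¹ * y₀) = x := by
        rw [← mul_assoc, ← mul_assoc, mul_right_comm _ y₀⁻¹, mul_mul_inv_cancel_of_mem hzO,
          mul_inv_mul_cancel_of_mem hy₀O]
      rw [Set.mem_ofPred_eq, h2] at h1
      exact Metric.ball_subset_closedBall h1
    let g' : 𝓓(Ω, 𝕜) := (g z).dilate (z.1 * y₀⁻¹) hη fun x hx => hy₀ (hball x hx)
    have h3 := hN (g z) g' _ hη (fun _ => rfl) (y * (z.1⁻¹ * y₀))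
    have h4 : y * (z.1⁻¹ * y₀) * (z.1 * y₀⁻¹) = y := by
      rw [← mul_assoc, ← mul_assoc, mul_right_comm _ y₀, mul_inv_mul_cancel_of_mem hzO,
        mul_mul_inv_cancel_of_mem hy₀O]
    rw [h4] at h3
    rw [← h3]
    refine hK g' (((g z).tsupport_dilate_subset _ _ _).trans hball) _ fun hmem => ?_
    refine hw z z.2 ⟨y₀, rfl, _, hmem, ?_⟩
    change y₀ * (y * (z.1⁻¹ * y₀))⁻¹ = z.1 * y⁻¹
    rw [mul_inv, mul_inv, inv_inv, mul_comm y₀, ← mul_assoc, mul_inv_mul_cancel_of_mem hy₀O, mul_comm]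
  have hformula : ∀ (φ : 𝓓(Ω, 𝕜)) y (hy : y ∈ nonzeroCoords d),
      T (dilateTestFunction hΩ φ y hy) = N y φ := by
    intro φ y hy
    let P : 𝓓(W, 𝕜) →L[𝕜] 𝓓(Ω, 𝕜) := mulDilate W φ y⁻¹
    have h1 : ∀ k : {k // k ∈ Ω}, N k.1 (mulDilate (nonzeroCoords d) (χ'' k) k.1⁻¹
        (dilateTestFunction hΩ φ y hy)) = N y (P (χ' k)) := by
      intro k
      have h2 := hN (P (χ' k)) (mulDilate (nonzeroCoords d) (χ'' k) k.1⁻¹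
        (dilateTestFunction hΩ φ y hy)) (k.1⁻¹ * y) (mul_mem_nonzeroCoords (hk k) hy) (by
          intro z
          change χ' k (z * k.1⁻¹) * φ (z * k.1⁻¹ * y) =
            φ (z * (k.1⁻¹ * y)) * χ' k (z * (k.1⁻¹ * y) * y⁻¹)
          rw [← mul_assoc, mul_mul_inv_cancel_of_mem hy, mul_comm]) k.1
      rw [h2, ← mul_assoc, mul_inv_cancel_of_mem (hΩ k.2), one_mul]
    -- After dilation all pieces are evaluated at the same `y`, so they add up to `N y` of `φ` times
    -- `χ(· y⁻¹)`. Since `χ = 1` near `Q`, `hcut` kills the difference from `φ`.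
    rw [hT, Finset.sum_congr rfl fun k _ => h1 k, ← map_sum, ← map_sum, ← hχ', eq_comm,
      ← sub_eq_zero, ← map_sub]
    refine hcut _ y hy fun z hz hzQ => ?_
    have h3 : tsupport (φ - P χ : 𝓓(Ω, 𝕜)) ⊆ {z | z * y⁻¹ ∈ V}ᶜ := by
      refine closure_minimal (fun x hx hxV => hx ?_)
        (hV.preimage (by fun_prop)).isClosed_compl
      change φ x - φ x * χ (x * y⁻¹) = 0
      rw [hχ _ hxV, mul_one, sub_self]
    exact h3 hz (hQV hzQ)
  refine ⟨T, ⟨?_, ?_⟩, hformula⟩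
  · let C : Set (Fin d → ℝ) := ⋃ k ∈ t, tsupport (χ' k)
    have hC : IsCompact C := t.isCompact_biUnion fun k _ => (χ' k).hasCompactSupport
    have hCO : C ⊆ nonzeroCoords d := Set.iUnion₂_subset fun k _ => hWO k
    have hsub : Distribution.dsupport T ⊆ C := by
      intro x hx
      by_contra hxC
      refine (Distribution.notMem_dsupport_iff x).2 ⟨Cᶜ, fun f hf => ?_, hC.isClosed.isOpen_compl,
        hxC⟩ hx
      rw [hT]
      refine Finset.sum_eq_zero fun k hkt => ?_
      have : mulDilate (nonzeroCoords d) (χ'' k) k.1⁻¹ f = 0 := by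
        ext z
        change χ' k (z * k.1⁻¹) * f (z * k.1⁻¹) = 0
        by_cases hz : z * k.1⁻¹ ∈ tsupport f
        · have h1 : z * k.1⁻¹ ∉ tsupport (χ' k) := fun h =>
            hf hz (Set.mem_iUnion₂.2 ⟨k, hkt, h⟩)
          rw [image_eq_zero_of_notMem_tsupport h1, zero_mul]
        · rw [image_eq_zero_of_notMem_tsupport hz, mul_zero]
      rw [this, map_zero]
    have hs : supportIn T = Distribution.dsupport T :=
      Set.inter_eq_left.2 (hsub.trans hCO)
    rw [hs]
    exact hC.of_isClosed_subset Distribution.isClosed_dsupport hsub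
  · rintro _ ⟨x, hx, rfl⟩
    refine ⟨inv_mem_nonzeroCoords hx.2, fun z hz => ?_⟩
    -- If `y = x⁻¹ z` lies outside `Ω`, every test function supported close to `x` is a dilation by
    -- `y` of a test function on `Ω`. There `T` equals `N y = 0`, so `x` is not in the support.
    by_contra hcon
    have hyO : x⁻¹ * z ∈ nonzeroCoords d :=
      mul_mem_nonzeroCoords (inv_mem_nonzeroCoords hx.2) (hΩ hz)
    refine (Distribution.notMem_dsupport_iff x).2 ⟨{x' | x' * (x⁻¹ * z) ∈ Ω}, fun f hf => ?_,
      Ω.isOpen.preimage (by fun_prop), ?_⟩ hx.1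
    · let φ : 𝓓(Ω, 𝕜) := f.dilate (x⁻¹ * z)⁻¹ (inv_mem_nonzeroCoords hyO) (fun v hv => by
        have h1 := hf hv
        rwa [Set.mem_ofPred_eq, mul_inv_mul_cancel_of_mem hyO] at h1)
      have h2 : dilateTestFunction hΩ φ (x⁻¹ * z) hyO = f := by
        ext v
        change f (v * (x⁻¹ * z) * (x⁻¹ * z)⁻¹) = f v
        rw [mul_mul_inv_cancel_of_mem hyO]
      rw [← h2, hformula, hN0 _ hcon]
      rfl
    · change x * (x⁻¹ * z) ∈ Ω
      rwa [← mul_assoc, mul_inv_cancel_of_mem hx.2, one_mul]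

/-- Applied to `N y = A δ_y`, which is `φ ↦ M φ y` and vanishes for `y ∉ Ω` because `δ_y` does. -/
theorem exists_symbol_of_isHadamardOperator (hne : (Ω : Set (Fin d → ℝ)).Nonempty)
    (hΩ : Ω ≤ nonzeroCoords d) {L : ScalarDistribution 𝕜 Ω → ScalarDistribution 𝕜 Ω}
    (hL : IsHadamardOperator L) :
    ∃ T : ScalarDistribution 𝕜 (nonzeroCoords d), IsHadamardSymbol Ω T ∧
      ∀ S, IsMulConv hΩ S T (L S) := by
  obtain ⟨A, rfl, hA⟩ := hL
  obtain ⟨y₀, hy₀⟩ := hne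
  obtain ⟨r, hr, hball⟩ := Metric.nhds_basis_closedBall.mem_iff.1 (Ω.isOpen.mem_nhds hy₀)
  obtain ⟨K', hK', hK'Ω, hK⟩ := exists_support_bound A
    (K := ⟨Metric.closedBall y₀ r, isCompact_closedBall y₀ r⟩) hball
  obtain ⟨M, hM⟩ := exists_transpose A
  obtain ⟨T, hT, hTM⟩ := exists_symbol_of_dilate hΩ (fun y => A (diracDistribution 𝕜 Ω y))
    (fun y hy => by
      have : diracDistribution 𝕜 Ω y = 0 := by
        ext φ
        exact φ.eq_zero_of_notMem hy
      rw [this, map_zero])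
    (fun φ φ' η hη h y => by
      rw [mul_comm y]
      exact transpose_dilate hA hη (fun z => by rw [h, mul_comm]) y)
    hr hball hK' hK'Ω hK
  refine ⟨T, hT, fun S φ => ⟨M φ, fun y hy => ?_, hM S φ⟩⟩
  rw [hTM, hM]
  rfl

end Construction

end

theorem theorem5p3 {𝕜 : Type*} [RCLike 𝕜] {d : ℕ} (Ω : Opens (Fin d → ℝ))
    (hne : (Ω : Set (Fin d → ℝ)).Nonempty) (hΩ : Ω ≤ nonzeroCoords d) :
    (∀ T : ScalarDistribution 𝕜 (nonzeroCoords d), IsHadamardSymbol Ω T →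
      ∀ S : ScalarDistribution 𝕜 Ω, ∃ R : ScalarDistribution 𝕜 Ω, IsMulConv hΩ S T R) ∧
    ∀ L : ScalarDistribution 𝕜 Ω → ScalarDistribution 𝕜 Ω,
      IsHadamardOperator L ↔
        ∃ T : ScalarDistribution 𝕜 (nonzeroCoords d), IsHadamardSymbol Ω T ∧
          ∀ S : ScalarDistribution 𝕜 Ω, IsMulConv hΩ S T (L S) :=
  ⟨fun _ hT S => hT.exists_isMulConv hΩ S, fun _ =>
    ⟨exists_symbol_of_isHadamardOperator hne hΩ,
      fun ⟨_, hT, hL⟩ => isHadamardOperator_of_symbol hne hΩ hT hL⟩⟩
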